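/- Let $0<L_1\le L_2$, $L=L_1+L_2$, and suppose that $L_1/L$ is irrational. For either sign, consider the problem of finding the pairs $(\omega,u)$ with $$(P_\pm)\qquad -u''-u^3=\omega u \ \text{ on } [0,L],\quad u\in H^2_{\mathrm{per}}([0,L]),\quad \omega<0,\quad u(0)=\pm u(L_1)=\sqrt{2|\omega|},$$ where $H^2_{\mathrm{per}}([0,L])=\{u\in H^2([0,L]): u(0)=u(L),\ u'(0)=u'(L)\}$ and $u$ is real-valued. Let $[\cdot]$ be the floor function, let $\operatorname{cn}(\cdot\,;k)$ be the Jacobi cnoidal function with modulus $k$, let $K(k)=\int_0^1\frac{dt}{\sqrt{(1-t^2)(1-k^2t^2)}}$, and for $k\in(1/\sqrt2,1)$ put $$S(k)=4\sqrt{2k^2-1}\,K(k),\qquad \varphi(k)=\frac1{K(k)}\int_{\sqrt{(2k^2-1)/k^2}}^1\frac{dt}{\sqrt{(1-t^2)\,(1-k^2(1-t^2))}} .$$ Then $S:(1/\sqrt2,1)\to(0,\infty)$ and $\varphi:(1/\sqrt2,1)\to(0,1)$ are bijections; let $G=S\circ\varphi^{-1}:(0,1)\to(0,\infty)$. For $n\ge1$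 put $r_n=\frac{L_1}{L}n-\left[\frac{L_1}{L}n+\frac12\right]$ and $\xi_n=2|r_n|$; then $\xi_n\in(0,1)$. Let $\omega_n^\pm<0$ be the unique negative solutions of $$\sqrt{|\omega_n^+|}=\frac nL\,G(\xi_n),\qquad \sqrt{|\omega_n^-|}=\frac nL\,G(1-\xi_n).$$ The set of all the solutions of $(P_\pm)$ is countable and infinite, and it is exactly $\{(\omega_n^\pm,u_n^\pm): n\ge1\}$, where $u_n^\pm$ is (the restriction to $[0,L]$ of) $$u_n^\pm(x)=\sqrt{\frac{2|\omega_n^\pm|k_n^2}{2k_n^2-1}}\ \operatorname{cn}\!\left(\sqrt{\frac{|\omega_n^\pm|}{2k_n^2-1}}\,(x-s_n^\pm);k_n\right),\qquad k_n=S^{-1}\!\left(L\frac{\sqrt{|\omega_n^\pm|}}{n}\right),$$ $$s_n^+=\frac{L}{2n}\,r_n,\qquad s_n^-=\frac{L}{2n}\left(|r_n|-\frac12\right)\operatorname{sgn}(r_n).$$ As a function on $\mathbb R$, $u_n^\pm$ has minimal period $L/n$. -/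

import Mathlib

open MeasureTheory Set


namespace DoubleBridge

noncomputable section

/-! ### Elliptic functions -/

/-- The complete elliptic integral of the first kind, with modulus `k`. -/
def ellipticK (k : ℝ) : ℝ :=
  ∫ t in (0 : ℝ)..1, 1 / Real.sqrt ((1 - t ^ 2) * (1 - k ^ 2 * t ^ 2))

/-- The incomplete elliptic integral of the first kind, as a function of the angle. -/
def ellipticF (k a : ℝ) : ℝ :=
  ∫ θ in (0 : ℝ)..a, 1 / Real.sqrt (1 - k ^ 2 * Real.sin θ ^ 2)

/-- The Jacobi amplitude `am(x; k)`, for `0 ≤ k < 1`: the inverse of the increasing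
bijection `ellipticF k` of the real line. -/
def jacobiAm (x k : ℝ) : ℝ :=
  Function.invFun (ellipticF k) x

/-- The Jacobi cnoidal function `cn(x; k)` with modulus `k`. -/
def jacobiCn (x k : ℝ) : ℝ :=
  Real.cos (jacobiAm x k)

/-- The interval `(1/√2, 1)` of admissible moduli. -/
def moduli : Set ℝ :=
  Ioo (1 / Real.sqrt 2) 1

/-- `S(k) = 4 √(2k² - 1) K(k)`, considered for `k ∈ (1/√2, 1)`. -/
def S (k : ℝ) : ℝ :=
  4 * Real.sqrt (2 * k ^ 2 - 1) * ellipticK k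

/-- The inverse of `S : (1/√2, 1) → (0, ∞)`. -/
def SInv (y : ℝ) : ℝ :=
  Function.invFunOn S moduli y

/-- The quotient of elliptic integrals `φ(k)`, considered for `k ∈ (1/√2, 1)`. -/
def phi (k : ℝ) : ℝ :=
  (∫ t in (Real.sqrt ((2 * k ^ 2 - 1) / k ^ 2))..1,
      1 / Real.sqrt ((1 - t ^ 2) * (1 - k ^ 2 * (1 - t ^ 2)))) /
    ∫ t in (0 : ℝ)..1, 1 / Real.sqrt ((1 - t ^ 2) * (1 - k ^ 2 * t ^ 2))

/-- The inverse of `φ : (1/√2, 1) → (0, 1)`. -/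
def phiInv (y : ℝ) : ℝ :=
  Function.invFunOn phi moduli y

/-- `G = S ∘ φ⁻¹`, on `(0, 1)`. -/
def G (y : ℝ) : ℝ :=
  S (phiInv y)

/-! ### The boundary value problems -/

/-- `g` is the weak derivative of `f` on `(0, L)`. -/
def HasWeakDeriv (L : ℝ) (f g : ℝ → ℝ) : Prop :=
  ∀ η : ℝ → ℝ, ContDiff ℝ ((⊤ : ℕ∞) : WithTop ℕ∞) η → HasCompactSupport η → tsupport η ⊆ Ioo 0 L →
    ∫ x in Ioo 0 L, f x * deriv η x = - ∫ x in Ioo 0 L, g x * η x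

/-- `u` belongs to `H²_per([0, L])`, with first and second weak derivatives `u'` and `u''`.
As usual in one dimension, `u` and `u'` are identified with their continuous
representatives on `[0, L]`, which gives a meaning to their values at the end points. -/
structure IsH2Per (L : ℝ) (u u' u'' : ℝ → ℝ) : Prop where
  memLp : MemLp u 2 (volume.restrict (Ioo 0 L))
  memLp_fst : MemLp u' 2 (volume.restrict (Ioo 0 L))
  memLp_snd : MemLp u'' 2 (volume.restrict (Ioo 0 L))
  weak_fst : HasWeakDeriv L u u'
  weak_snd : HasWeakDeriv L u' u''
  cont : ContinuousOn u (Icc 0 L)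
  cont_fst : ContinuousOn u' (Icc 0 L)
  periodic : u 0 = u L
  periodic_fst : u' 0 = u' L

/-- The set of the solutions `(ω, u)`, with `u` a real function on `[0, L]`, of
`-u'' - u³ = ω u`, `u ∈ H²_per([0, L])`, `ω < 0`, `u(0) = ε u(L₁) = √(2|ω|)`.
The problems `(P₊)` and `(P₋)` are the cases `ε = 1` and `ε = -1`. -/
def solutionSet (ε L₁ L : ℝ) : Set (ℝ × (Icc (0 : ℝ) L → ℝ)) :=
  {p | p.1 < 0 ∧ ∃ u u' u'' : ℝ → ℝ, IsH2Per L u u' u'' ∧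
    (∀ᵐ x ∂(volume.restrict (Ioo 0 L)), - u'' x - u x ^ 3 = p.1 * u x) ∧
    u 0 = Real.sqrt (2 * |p.1|) ∧ ε * u L₁ = Real.sqrt (2 * |p.1|) ∧
    p.2 = (Icc (0 : ℝ) L).domRestrict u}

/-! ### The explicit solutions -/

/-- `r_n = (L₁/L) n - ⌊(L₁/L) n + 1/2⌋`. -/
def r (L₁ L : ℝ) (n : ℕ) : ℝ :=
  L₁ / L * n - (⌊L₁ / L * n + 1 / 2⌋ : ℤ)

/-- `ξ_n = 2 |r_n|`. -/
def xi (L₁ L : ℝ) (n : ℕ) : ℝ :=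
  2 * |r L₁ L n|

/-- The shift `s_n⁺`. -/
def sPlus (L₁ L : ℝ) (n : ℕ) : ℝ :=
  L / (2 * n) * r L₁ L n

/-- The shift `s_n⁻`. -/
def sMinus (L₁ L : ℝ) (n : ℕ) : ℝ :=
  L / (2 * n) * (|r L₁ L n| - 1 / 2) * Real.sign (r L₁ L n)

/-- The modulus `S⁻¹(L √|ω| / n)`. -/
def modulus (L ω : ℝ) (n : ℕ) : ℝ :=
  SInv (L * (Real.sqrt |ω| / n))

/-- The rescaled cnoidal function of frequency `ω` and modulus `k = S⁻¹(L √|ω| / n)`,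
translated by `s`. -/
def profile (L ω : ℝ) (n : ℕ) (s x : ℝ) : ℝ :=
  Real.sqrt (2 * |ω| * modulus L ω n ^ 2 / (2 * modulus L ω n ^ 2 - 1)) *
    jacobiCn (Real.sqrt (|ω| / (2 * modulus L ω n ^ 2 - 1)) * (x - s)) (modulus L ω n)

end

end DoubleBridge

/-!
The first integral `u'² + u⁴/2 + ω u²` confines each solution to a level curve of the phase plane.
The value `u(0) = √(2|ω|)` puts it on the homoclinic curve, which carries no periodic solution, if
`u'(0) = 0`, and on a closed curve around both wells if `u'(0) ≠ 0`; by uniqueness for the Cauchy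
problem, `u` is then a sign-changing cnoidal wave with modulus `k ∈ (1/√2, 1)`. Periodicity
quantizes its wave number: `u` has `n ≥ 1` periods in `[0, L]`.

Measure phases in periods from a maximum of the wave. The level `√(2|ω|)` is attained exactly at
the phases congruent to `±φ(k)/4` modulo `1`. The phases of `0` and `L₁` differ by `L₁n/L`, which is
not an integer, so one crossing is ascending and the other descending, and `L₁n/L ≡ ±φ(k)/2`. This
determines `φ(k) = 2|r_n|`, hence `k`, and the shift is half of `r_n`. Since half a period changes
the sign of the wave, `(P₋)` is the same problem with `L₁n/L` replaced by `L₁n/L - 1/2`.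
-/

namespace DoubleBridge

open Real Filter Topology

section EllipticIntegrals

variable {k : ℝ}

/-- Legendre's `Δ(θ, k) = √(1 - k² sin² θ)`, whose reciprocal is the integrand of `ellipticF`. -/
noncomputable def legendreDelta (k θ : ℝ) : ℝ :=
  √(1 - k ^ 2 * sin θ ^ 2)

lemma one_sub_mul_sin_sq_pos (hk : k ^ 2 < 1) (θ : ℝ) : 0 < 1 - k ^ 2 * sin θ ^ 2 := by
  have : k ^ 2 * sin θ ^ 2 ≤ k ^ 2 := mul_le_of_le_one_right (sq_nonneg k) (sin_sq_le_one θ)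
  linarith

lemma legendreDelta_sq (hk : k ^ 2 < 1) (θ : ℝ) :
    legendreDelta k θ ^ 2 = 1 - k ^ 2 * sin θ ^ 2 :=
  sq_sqrt (one_sub_mul_sin_sq_pos hk θ).le

lemma legendreDelta_pos (hk : k ^ 2 < 1) (θ : ℝ) : 0 < legendreDelta k θ :=
  sqrt_pos.2 (one_sub_mul_sin_sq_pos hk θ)

lemma legendreDelta_le_one (k θ : ℝ) : legendreDelta k θ ≤ 1 :=
  sqrt_le_one.2 (sub_le_self _ (by positivity))

lemma legendreDelta_add_int_mul_pi (k θ : ℝ) (m : ℤ) :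
    legendreDelta k (θ + m * π) = legendreDelta k θ := by
  rw [legendreDelta, sin_add_int_mul_pi, mul_pow, ← zpow_natCast ((-1 : ℝ) ^ m), ← zpow_mul,
    mul_comm m, zpow_mul]
  simp [legendreDelta]

lemma continuous_one_div_legendreDelta (hk : k ^ 2 < 1) :
    Continuous fun θ => 1 / legendreDelta k θ :=
  continuous_const.div (by unfold legendreDelta; fun_prop) fun θ => (legendreDelta_pos hk θ).ne'

lemma intervalIntegrable_one_div_legendreDelta (hk : k ^ 2 < 1) (a b : ℝ) :
    IntervalIntegrable (fun θ => 1 / legendreDelta k θ) volume a b :=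
  (continuous_one_div_legendreDelta hk).intervalIntegrable a b

lemma ellipticF_sub (hk : k ^ 2 < 1) (a b : ℝ) :
    ellipticF k b - ellipticF k a = ∫ θ in a..b, 1 / legendreDelta k θ :=
  intervalIntegral.integral_interval_sub_left (intervalIntegrable_one_div_legendreDelta hk _ _)
    (intervalIntegrable_one_div_legendreDelta hk _ _)

lemma hasDerivAt_ellipticF (hk : k ^ 2 < 1) (a : ℝ) :
    HasDerivAt (ellipticF k) (1 / legendreDelta k a) a :=
  ((continuous_one_div_legendreDelta hk).integral_hasStrictDerivAt 0 a).hasDerivAt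

lemma continuous_ellipticF (hk : k ^ 2 < 1) : Continuous (ellipticF k) :=
  continuous_iff_continuousAt.2 fun a => (hasDerivAt_ellipticF hk a).continuousAt

lemma strictMono_ellipticF (hk : k ^ 2 < 1) : StrictMono (ellipticF k) :=
  strictMono_of_hasDerivAt_pos (hasDerivAt_ellipticF hk) fun a =>
    one_div_pos.2 (legendreDelta_pos hk a)

@[simp]
lemma ellipticF_zero (k : ℝ) : ellipticF k 0 = 0 :=
  intervalIntegral.integral_same

lemma ellipticF_neg (k a : ℝ) : ellipticF k (-a) = -ellipticF k a := by
  have h := intervalIntegral.integral_comp_neg (a := 0) (b := a)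
    fun θ => 1 / √(1 - k ^ 2 * sin θ ^ 2)
  simp only [sin_neg, neg_sq, neg_zero] at h
  rw [ellipticF, ellipticF, h, intervalIntegral.integral_symm]

lemma le_ellipticF (hk : k ^ 2 < 1) {a : ℝ} (ha : 0 ≤ a) : a ≤ ellipticF k a := by
  have := intervalIntegral.integral_mono_on ha (intervalIntegrable_const (c := (1 : ℝ)))
    (intervalIntegrable_one_div_legendreDelta hk 0 a) fun θ _ =>
      (one_le_div (legendreDelta_pos hk θ)).2 (legendreDelta_le_one k θ)
  simpa [ellipticF, legendreDelta] using this

lemma ellipticF_le_of_sq_le_sq {k₁ k₂ a : ℝ} (h : k₁ ^ 2 ≤ k₂ ^ 2) (h₂ : k₂ ^ 2 < 1) (ha : 0 ≤ a) :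
    ellipticF k₁ a ≤ ellipticF k₂ a := by
  refine intervalIntegral.integral_mono_on ha
    (intervalIntegrable_one_div_legendreDelta (h.trans_lt h₂) _ _)
    (intervalIntegrable_one_div_legendreDelta h₂ _ _) fun θ _ => ?_
  refine one_div_le_one_div_of_le (legendreDelta_pos h₂ θ) (sqrt_le_sqrt ?_)
  gcongr

lemma surjective_ellipticF (hk : k ^ 2 < 1) : Function.Surjective (ellipticF k) := by
  have htop : Tendsto (ellipticF k) atTop atTop :=
    tendsto_atTop_mono' _ ((eventually_ge_atTop 0).mono fun _ => le_ellipticF hk) tendsto_id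
  refine (continuous_ellipticF hk).surjective htop ?_
  have hodd : ellipticF k = fun a => -ellipticF k (-a) := by
    funext a
    rw [ellipticF_neg, neg_neg]
  rw [hodd]
  exact tendsto_neg_atTop_atBot.comp (htop.comp tendsto_neg_atBot_atTop)

lemma image_cos_Ioo {a : ℝ} (ha : a ∈ Icc 0 π) : cos '' Ioo 0 a = Ioo (cos a) 1 := by
  rw [continuous_cos.continuousOn.image_Ioo_of_strictAntiOn ha.1
    (strictAntiOn_cos.mono (Icc_subset_Icc_right ha.2)), cos_zero]

lemma integral_div_sqrt_one_sub_sq (h : ℝ → ℝ) {a : ℝ} (ha : a ∈ Icc 0 π) :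
    ∫ t in (cos a)..1, h t / √(1 - t ^ 2) = ∫ θ in (0 : ℝ)..a, h (cos θ) := by
  rw [intervalIntegral.integral_of_le (cos_le_one a), intervalIntegral.integral_of_le ha.1,
    integral_Ioc_eq_integral_Ioo, integral_Ioc_eq_integral_Ioo, ← image_cos_Ioo ha,
    integral_image_eq_integral_abs_deriv_smul measurableSet_Ioo
      (fun θ _ => (hasDerivAt_cos θ).hasDerivWithinAt)
      (injOn_cos.mono (Ioo_subset_Icc_self.trans (Icc_subset_Icc_right ha.2)))]
  refine setIntegral_congr_fun measurableSet_Ioo fun θ hθ => ?_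
  have hsin : 0 < sin θ := sin_pos_of_pos_of_lt_pi hθ.1 (hθ.2.trans_le ha.2)
  simp only [smul_eq_mul, abs_neg, abs_of_pos hsin, ← sin_sq, sqrt_sq hsin.le,
    mul_div_cancel₀ _ hsin.ne']

lemma integral_one_div_sqrt_one_sub_sq_mul (g : ℝ → ℝ) {a : ℝ} (ha : a ∈ Icc 0 π) :
    ∫ t in (cos a)..1, 1 / √((1 - t ^ 2) * g t) = ∫ θ in (0 : ℝ)..a, 1 / √(g (cos θ)) := by
  rw [← integral_div_sqrt_one_sub_sq (fun t => 1 / √(g t)) ha]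
  refine intervalIntegral.integral_congr fun t ht => ?_
  rw [uIcc_of_le (cos_le_one a)] at ht
  have ht1 : 0 ≤ 1 - t ^ 2 := by nlinarith [ht.1, ht.2, neg_one_le_cos a]
  simp only [sqrt_mul ht1, div_div, mul_comm (√(g t))]

lemma ellipticK_eq_ellipticF (k : ℝ) : ellipticK k = ellipticF k (π / 2) := by
  have h := integral_one_div_sqrt_one_sub_sq_mul (fun t => 1 - k ^ 2 * t ^ 2)
    (a := π / 2) ⟨by positivity, by linarith [pi_pos]⟩
  rw [cos_pi_div_two] at h
  have hsub := intervalIntegral.integral_comp_sub_left (a := 0) (b := π / 2)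
    (fun θ => 1 / √(1 - k ^ 2 * sin θ ^ 2)) (π / 2)
  simp only [sin_pi_div_two_sub, sub_self, sub_zero] at hsub
  rw [ellipticK, h, hsub, ellipticF]

lemma integral_cos_eq_ellipticF (k : ℝ) {a : ℝ} (ha : a ∈ Icc 0 π) :
    ∫ t in (cos a)..1, 1 / √((1 - t ^ 2) * (1 - k ^ 2 * (1 - t ^ 2))) = ellipticF k a := by
  simp only [integral_one_div_sqrt_one_sub_sq_mul (fun t => 1 - k ^ 2 * (1 - t ^ 2)) ha, ← sin_sq,
    ellipticF]

lemma ellipticK_pos (hk : k ^ 2 < 1) : 0 < ellipticK k := by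
  rw [ellipticK_eq_ellipticF]
  exact pi_div_two_pos.trans_le (le_ellipticF hk pi_div_two_pos.le)

lemma ellipticF_add_int_mul_pi (hk : k ^ 2 < 1) (a : ℝ) (m : ℤ) :
    ellipticF k (a + m * π) = ellipticF k a + 2 * ellipticK k * m := by
  have hper : Function.Periodic (fun θ => 1 / legendreDelta k θ) π := fun θ => by
    simpa only [Int.cast_one, one_mul] using
      congrArg (1 / ·) (legendreDelta_add_int_mul_pi k θ 1)
  have hhalf : ∫ θ in (0 : ℝ)..π, 1 / legendreDelta k θ = 2 * ellipticK k := by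
    have h := hper.intervalIntegral_add_eq 0 (-(π / 2))
    rw [zero_add, show -(π / 2) + π = π / 2 by ring, ← ellipticF_sub hk (-(π / 2)),
      ellipticF_neg, ← ellipticK_eq_ellipticF] at h
    rw [h]
    ring
  have h := hper.intervalIntegral_add_zsmul_eq m a
    (intervalIntegrable_one_div_legendreDelta hk)
  rw [hper.intervalIntegral_add_eq a 0, zero_add, hhalf, ← ellipticF_sub hk, zsmul_eq_mul,
    zsmul_eq_mul] at h
  linarith

lemma neg_log_one_sub_div_two_le_ellipticK (hk₀ : 0 ≤ k) (hk₁ : k < 1) :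
    -log (1 - k) / 2 ≤ ellipticK k := by
  have hk : k ^ 2 < 1 := pow_lt_one₀ hk₀ hk₁ two_ne_zero
  have hpos : ∀ θ, 0 < 1 - k * sin θ := fun θ => by nlinarith [sin_le_one θ]
  have hderiv : ∀ θ, HasDerivAt (fun θ => -log (1 - k * sin θ) / 2)
      (k * cos θ / (2 * (1 - k * sin θ))) θ := fun θ => by
    refine (((((hasDerivAt_sin θ).const_mul k).const_sub 1).log (hpos θ).ne').neg.div_const
      2).congr_deriv ?_
    field_simp
  have hcont : Continuous fun θ => k * cos θ / (2 * (1 - k * sin θ)) :=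
    Continuous.div (by fun_prop) (by fun_prop) fun θ => (mul_pos two_pos (hpos θ)).ne'
  have hle : ∀ θ, k * cos θ / (2 * (1 - k * sin θ)) ≤ 1 / legendreDelta k θ := fun θ => by
    have hΔ := legendreDelta_pos hk θ
    have hsq := legendreDelta_sq hk θ
    have hcos : k * cos θ ≤ legendreDelta k θ :=
      le_of_sq_le_sq (by nlinarith [sin_sq_add_cos_sq θ]) hΔ.le
    rw [div_le_div_iff₀ (mul_pos two_pos (hpos θ)) hΔ, one_mul]
    nlinarith [mul_le_mul_of_nonneg_right hcos hΔ.le, sq_nonneg (1 - k * sin θ)]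
  have hFTC := intervalIntegral.integral_eq_sub_of_hasDerivAt (a := 0) (b := π / 2)
    (fun θ _ => hderiv θ) (hcont.intervalIntegrable _ _)
  have hmono := intervalIntegral.integral_mono_on pi_div_two_pos.le
    (hcont.intervalIntegrable 0 (π / 2)) (intervalIntegrable_one_div_legendreDelta hk _ _)
    fun θ _ => hle θ
  rw [hFTC] at hmono
  rw [ellipticK_eq_ellipticF]
  simpa [ellipticF, legendreDelta] using hmono

lemma tendsto_ellipticK_atTop : Tendsto ellipticK (𝓝[<] 1) atTop := by
  have hsub : Tendsto (fun k : ℝ => 1 - k) (𝓝[<] 1) (𝓝[>] 0) := by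
    refine tendsto_nhdsWithin_iff.2 ⟨?_, ?_⟩
    · exact ((continuous_const.sub continuous_id).tendsto' 1 0 (sub_self 1)).mono_left
        nhdsWithin_le_nhds
    · filter_upwards [self_mem_nhdsWithin] with k hk
      exact sub_pos.2 (mem_Iio.1 hk)
  have hlog : Tendsto (fun k : ℝ => -log (1 - k) / 2) (𝓝[<] 1) atTop :=
    (tendsto_neg_atBot_atTop.comp (tendsto_log_nhdsGT_zero.comp hsub)).atTop_div_const two_pos
  refine tendsto_atTop_mono' _ ?_ hlog
  filter_upwards [Ioo_mem_nhdsLT (zero_lt_one (α := ℝ))] with k hk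
  exact neg_log_one_sub_div_two_le_ellipticK hk.1.le hk.2

-- Replacing `k` by `min |k| c` with `c < 1` makes the integrand jointly continuous everywhere.
lemma continuousOn_uncurry_ellipticF :
    ContinuousOn (fun p : ℝ × ℝ => ellipticF p.1 p.2) {p | p.1 ^ 2 < 1} := by
  intro p hp
  obtain ⟨c, hpc, hc⟩ := exists_between ((sq_lt_one_iff_abs_lt_one p.1).1 hp)
  have hcut : ∀ k : ℝ, (min |k| c) ^ 2 < 1 := fun k =>
    pow_lt_one₀ (le_min (abs_nonneg _) ((abs_nonneg _).trans hpc.le))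
      ((min_le_right _ _).trans_lt hc) two_ne_zero
  have hcont : Continuous fun q : ℝ × ℝ => ellipticF (min |q.1| c) q.2 := by
    refine intervalIntegral.continuous_parametric_intervalIntegral_of_continuous
      (f := fun (q : ℝ × ℝ) θ => 1 / legendreDelta (min |q.1| c) θ) (a₀ := 0) ?_ continuous_snd
    exact continuous_const.div (by unfold legendreDelta; fun_prop)
      fun q => (legendreDelta_pos (hcut _) _).ne'
  refine (hcont.continuousAt.congr ?_).continuousWithinAt
  filter_upwards [(continuous_fst.abs.tendsto p).eventually_lt_const hpc] with q hq
  simp only [ellipticF, min_eq_left hq.le, sq_abs]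

lemma continuousOn_ellipticF_comp {s : Set ℝ} {κ a : ℝ → ℝ} (hκ : ContinuousOn κ s)
    (ha : ContinuousOn a s) (hs : ∀ x ∈ s, κ x ^ 2 < 1) :
    ContinuousOn (fun x => ellipticF (κ x) (a x)) s :=
  continuousOn_uncurry_ellipticF.comp (f := fun x => (κ x, a x)) (hκ.prodMk ha) hs

lemma continuousOn_ellipticK : ContinuousOn ellipticK {k | k ^ 2 < 1} := by
  simp only [funext ellipticK_eq_ellipticF]
  exact continuousOn_ellipticF_comp continuousOn_id continuousOn_const fun _ hk => hk

end EllipticIntegrals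

section Moduli

lemma sq_one_div_sqrt_two : (1 / √2 : ℝ) ^ 2 = 1 / 2 := by
  rw [div_pow, sq_sqrt zero_le_two, one_pow]

lemma one_div_sqrt_two_mem_Ioo : 1 / √2 ∈ Ioo (0 : ℝ) 1 := by
  have h : (1 / √2 : ℝ) ^ 2 < 1 ^ 2 := by rw [sq_one_div_sqrt_two]; norm_num
  exact ⟨by positivity, lt_of_pow_lt_pow_left₀ 2 zero_le_one h⟩

variable {k : ℝ}

lemma moduli_subset_Ioo : moduli ⊆ Ioo 0 1 :=
  Ioo_subset_Ioo_left one_div_sqrt_two_mem_Ioo.1.le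

lemma sq_lt_one_of_mem_Ioo (hk : k ∈ Ioo 0 1) : k ^ 2 < 1 :=
  pow_lt_one₀ hk.1.le hk.2 two_ne_zero

lemma pos_of_mem_moduli (hk : k ∈ moduli) : 0 < k :=
  (moduli_subset_Ioo hk).1

lemma sq_lt_one_of_mem_moduli (hk : k ∈ moduli) : k ^ 2 < 1 :=
  sq_lt_one_of_mem_Ioo (moduli_subset_Ioo hk)

lemma two_mul_sq_sub_one_pos (hk : k ∈ moduli) : 0 < 2 * k ^ 2 - 1 := by
  have : (1 / √2) ^ 2 < k ^ 2 := pow_lt_pow_left₀ hk.1 (by positivity) two_ne_zero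
  rw [sq_one_div_sqrt_two] at this
  linarith

lemma mem_moduli_of_sq_mem (hk : 0 < k) (h : k ^ 2 ∈ Ioo (1 / 2) 1) : k ∈ moduli :=
  ⟨lt_of_pow_lt_pow_left₀ 2 hk.le (sq_one_div_sqrt_two.trans_lt h.1),
    (sq_lt_one_iff₀ hk.le).1 h.2⟩

lemma S_pos (hk : k ∈ moduli) : 0 < S k :=
  mul_pos (mul_pos four_pos (sqrt_pos.2 (two_mul_sq_sub_one_pos hk)))
    (ellipticK_pos (sq_lt_one_of_mem_moduli hk))

lemma strictMonoOn_S : StrictMonoOn S moduli := by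
  intro k₁ h₁ k₂ h₂ h
  have hsq : k₁ ^ 2 < k₂ ^ 2 := pow_lt_pow_left₀ h (pos_of_mem_moduli h₁).le two_ne_zero
  have hK : ellipticK k₁ ≤ ellipticK k₂ := by
    rw [ellipticK_eq_ellipticF, ellipticK_eq_ellipticF]
    exact ellipticF_le_of_sq_le_sq hsq.le (sq_lt_one_of_mem_moduli h₂) pi_div_two_pos.le
  have hsqrt : √(2 * k₁ ^ 2 - 1) < √(2 * k₂ ^ 2 - 1) :=
    sqrt_lt_sqrt (two_mul_sq_sub_one_pos h₁).le (by linarith)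
  exact mul_lt_mul (by linarith) hK (ellipticK_pos (sq_lt_one_of_mem_moduli h₁)) (by positivity)

lemma continuousOn_S : ContinuousOn S {k | k ^ 2 < 1} :=
  ContinuousOn.mul (by fun_prop) continuousOn_ellipticK

lemma tendsto_S_nhdsGT : Tendsto S (𝓝[>] (1 / √2)) (𝓝 0) := by
  have hS : S (1 / √2) = 0 := by
    rw [S, sq_one_div_sqrt_two]
    norm_num
  have hopen : IsOpen {k : ℝ | k ^ 2 < 1} := isOpen_lt (by fun_prop) continuous_const
  have hcont := continuousOn_S.continuousAt
    (hopen.mem_nhds (sq_lt_one_of_mem_Ioo one_div_sqrt_two_mem_Ioo))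
  exact hS ▸ hcont.tendsto.mono_left nhdsWithin_le_nhds

lemma tendsto_S_nhdsLT : Tendsto S (𝓝[<] 1) atTop := by
  have hsqrt : Tendsto (fun k : ℝ => 4 * √(2 * k ^ 2 - 1)) (𝓝[<] 1) (𝓝 4) :=
    (Continuous.tendsto' (by fun_prop) 1 4 (by norm_num)).mono_left nhdsWithin_le_nhds
  exact hsqrt.pos_mul_atTop four_pos tendsto_ellipticK_atTop

lemma moduli_mem_nhdsGT : moduli ∈ 𝓝[>] (1 / √2) :=
  Ioo_mem_nhdsGT one_div_sqrt_two_mem_Ioo.2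

lemma moduli_mem_nhdsLT : moduli ∈ 𝓝[<] (1 : ℝ) :=
  Ioo_mem_nhdsLT one_div_sqrt_two_mem_Ioo.2

lemma bijOn_S : BijOn S moduli (Ioi 0) :=
  ⟨fun _ => S_pos, strictMonoOn_S.injOn,
    isPreconnected_Ioo.intermediate_value_Ioi (le_principal_iff.2 moduli_mem_nhdsGT)
      (le_principal_iff.2 moduli_mem_nhdsLT)
      (continuousOn_S.mono fun _ => sq_lt_one_of_mem_moduli) tendsto_S_nhdsGT tendsto_S_nhdsLT⟩

/-- The amplitude `θ ∈ [0, π/2]` with `cos² θ = (2k² - 1) / k²`: it is where the cnoidal wave of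
modulus `k` crosses the level `√(2|ω|)`, and `φ(k) = F(θ, k) / K(k)`. -/
noncomputable def crossingAngle (k : ℝ) : ℝ :=
  arccos √((2 * k ^ 2 - 1) / k ^ 2)

lemma two_mul_sq_sub_one_div_sq_lt_one (hk : k ^ 2 < 1) : (2 * k ^ 2 - 1) / k ^ 2 < 1 := by
  rcases (sq_nonneg k).eq_or_lt with h | h
  · simp [← h]
  · rw [div_lt_one h]
    linarith

lemma cos_crossingAngle (hk : k ^ 2 < 1) :
    cos (crossingAngle k) = √((2 * k ^ 2 - 1) / k ^ 2) :=
  cos_arccos (neg_one_lt_zero.le.trans (sqrt_nonneg _))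
    (sqrt_le_one.2 (two_mul_sq_sub_one_div_sq_lt_one hk).le)

lemma crossingAngle_mem_Icc (k : ℝ) : crossingAngle k ∈ Icc 0 (π / 2) :=
  ⟨arccos_nonneg _, arccos_le_pi_div_two.2 (sqrt_nonneg _)⟩

lemma crossingAngle_mem_Ioo (hk : k ∈ moduli) : crossingAngle k ∈ Ioo 0 (π / 2) := by
  refine ⟨arccos_pos.2 ?_, arccos_lt_pi_div_two.2 (sqrt_pos.2
    (div_pos (two_mul_sq_sub_one_pos hk) (pow_pos (pos_of_mem_moduli hk) 2)))⟩
  rw [sqrt_lt' one_pos, one_pow]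
  exact two_mul_sq_sub_one_div_sq_lt_one (sq_lt_one_of_mem_moduli hk)

lemma legendreDelta_crossingAngle (hk : k ∈ moduli) :
    legendreDelta k (crossingAngle k) = k := by
  have hk₀ := pos_of_mem_moduli hk
  have hcos : k ^ 2 * cos (crossingAngle k) ^ 2 = 2 * k ^ 2 - 1 := by
    rw [cos_crossingAngle (sq_lt_one_of_mem_moduli hk),
      sq_sqrt (div_nonneg (two_mul_sq_sub_one_pos hk).le (sq_nonneg k)),
      mul_div_cancel₀ _ (pow_pos hk₀ 2).ne']
  rw [legendreDelta, sin_sq, show 1 - k ^ 2 * (1 - cos (crossingAngle k) ^ 2) = k ^ 2 by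
    linarith, sqrt_sq hk₀.le]

lemma strictAntiOn_crossingAngle : StrictAntiOn crossingAngle moduli := by
  intro k₁ h₁ k₂ h₂ h
  have hk₁ := pow_pos (pos_of_mem_moduli h₁) 2
  have hsq : k₁ ^ 2 < k₂ ^ 2 := pow_lt_pow_left₀ h (pos_of_mem_moduli h₁).le two_ne_zero
  refine arccos_lt_arccos (neg_one_lt_zero.le.trans (sqrt_nonneg _))
    (sqrt_lt_sqrt (div_nonneg (two_mul_sq_sub_one_pos h₁).le hk₁.le) ?_)
    (sqrt_le_one.2 (two_mul_sq_sub_one_div_sq_lt_one (sq_lt_one_of_mem_moduli h₂)).le)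
  rw [div_lt_div_iff₀ hk₁ (hk₁.trans hsq)]
  linarith

lemma continuousOn_crossingAngle : ContinuousOn crossingAngle {k | k ≠ 0} :=
  continuous_arccos.comp_continuousOn (continuous_sqrt.comp_continuousOn
    (ContinuousOn.div (by fun_prop) (by fun_prop) fun _ hk => pow_ne_zero 2 hk))

lemma phi_eq_ellipticF_div_ellipticK (hk : k ^ 2 < 1) :
    phi k = ellipticF k (crossingAngle k) / ellipticK k := by
  have h := crossingAngle_mem_Icc k
  rw [← integral_cos_eq_ellipticF k ⟨h.1, h.2.trans (by linarith [pi_pos])⟩, cos_crossingAngle hk]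
  rfl

lemma phi_mem_Ioo (hk : k ∈ moduli) : phi k ∈ Ioo 0 1 := by
  have hk₁ := sq_lt_one_of_mem_moduli hk
  obtain ⟨hpos, hlt⟩ := crossingAngle_mem_Ioo hk
  rw [phi_eq_ellipticF_div_ellipticK hk₁]
  refine ⟨div_pos (hpos.trans_le (le_ellipticF hk₁ hpos.le)) (ellipticK_pos hk₁), ?_⟩
  rw [div_lt_one (ellipticK_pos hk₁), ellipticK_eq_ellipticF]
  exact strictMono_ellipticF hk₁ hlt

lemma integral_mul_integral_le_of_forall_mul_le {f g : ℝ → ℝ} {a b c : ℝ} (hac : a ≤ c)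
    (hcb : c ≤ b) (hf : IntervalIntegrable f volume a c) (hf' : IntervalIntegrable f volume c b)
    (hg : IntervalIntegrable g volume a c) (hg' : IntervalIntegrable g volume c b)
    (h : ∀ s ∈ Icc a c, ∀ t ∈ Icc c b, f s * g t ≤ f t * g s) :
    (∫ s in a..c, f s) * ∫ t in c..b, g t ≤ (∫ t in c..b, f t) * ∫ s in a..c, g s := by
  have hleft : ∀ t ∈ Icc c b, (∫ s in a..c, f s) * g t ≤ f t * ∫ s in a..c, g s := by
    intro t ht
    rw [← intervalIntegral.integral_mul_const, ← intervalIntegral.integral_const_mul]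
    exact intervalIntegral.integral_mono_on hac (hf.mul_const _) (hg.const_mul _)
      fun s hs => h s hs t ht
  rw [← intervalIntegral.integral_const_mul, ← intervalIntegral.integral_mul_const]
  exact intervalIntegral.integral_mono_on hcb (hg'.const_mul _) (hf'.mul_const _) hleft

lemma one_div_legendreDelta_mul_le {k₁ k₂ s t : ℝ} (h : k₁ ^ 2 ≤ k₂ ^ 2) (h₂ : k₂ ^ 2 < 1)
    (hst : sin s ^ 2 ≤ sin t ^ 2) :
    1 / legendreDelta k₂ s * (1 / legendreDelta k₁ t) ≤
      1 / legendreDelta k₂ t * (1 / legendreDelta k₁ s) := by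
  have h₁ := h.trans_lt h₂
  have hs := one_sub_mul_sin_sq_pos h₂ s
  have ht := one_sub_mul_sin_sq_pos h₂ t
  rw [one_div_mul_one_div, one_div_mul_one_div]
  refine one_div_le_one_div_of_le (mul_pos (legendreDelta_pos h₂ t) (legendreDelta_pos h₁ s)) ?_
  simp only [legendreDelta]
  rw [← sqrt_mul hs.le, ← sqrt_mul ht.le]
  refine sqrt_le_sqrt ?_
  nlinarith [mul_nonneg (sub_nonneg.2 h) (sub_nonneg.2 hst)]

lemma sin_sq_le_sin_sq {s t : ℝ} (hs : 0 ≤ s) (hst : s ≤ t) (ht : t ≤ π / 2) :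
    sin s ^ 2 ≤ sin t ^ 2 :=
  pow_le_pow_left₀ (sin_nonneg_of_nonneg_of_le_pi hs (by linarith [pi_pos]))
    (sin_le_sin_of_le_of_le_pi_div_two (by linarith [pi_pos]) ht hst) 2

lemma ellipticF_div_ellipticK_le {k₁ k₂ a : ℝ} (h : k₁ ^ 2 ≤ k₂ ^ 2) (h₂ : k₂ ^ 2 < 1)
    (ha : a ∈ Icc 0 (π / 2)) :
    ellipticF k₂ a / ellipticK k₂ ≤ ellipticF k₁ a / ellipticK k₁ := by
  have h₁ := h.trans_lt h₂
  have hint {k : ℝ} (hk : k ^ 2 < 1) := intervalIntegrable_one_div_legendreDelta hk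
  have hcross := integral_mul_integral_le_of_forall_mul_le ha.1 ha.2 (hint h₂ _ _) (hint h₂ _ _)
    (hint h₁ _ _) (hint h₁ _ _) fun s hs t ht =>
      one_div_legendreDelta_mul_le h h₂ (sin_sq_le_sin_sq hs.1 (hs.2.trans ht.1) ht.2)
  simp only [← ellipticF_sub h₁, ← ellipticF_sub h₂, ellipticF_zero, sub_zero,
    ← ellipticK_eq_ellipticF] at hcross
  rw [div_le_div_iff₀ (ellipticK_pos h₂) (ellipticK_pos h₁)]
  linarith

lemma strictAntiOn_phi : StrictAntiOn phi moduli := by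
  intro k₁ hk₁ k₂ hk₂ h
  have h₁ := sq_lt_one_of_mem_moduli hk₁
  have h₂ := sq_lt_one_of_mem_moduli hk₂
  have hsq : k₁ ^ 2 ≤ k₂ ^ 2 := pow_le_pow_left₀ (pos_of_mem_moduli hk₁).le h.le 2
  calc phi k₂ = ellipticF k₂ (crossingAngle k₂) / ellipticK k₂ := phi_eq_ellipticF_div_ellipticK h₂
    _ ≤ ellipticF k₁ (crossingAngle k₂) / ellipticK k₁ :=
      ellipticF_div_ellipticK_le hsq h₂ (crossingAngle_mem_Icc k₂)
    _ < ellipticF k₁ (crossingAngle k₁) / ellipticK k₁ := by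
      gcongr
      · exact ellipticK_pos h₁
      · exact strictMono_ellipticF h₁ (strictAntiOn_crossingAngle hk₁ hk₂ h)
    _ = phi k₁ := (phi_eq_ellipticF_div_ellipticK h₁).symm

lemma continuousOn_phi : ContinuousOn phi (Ioo 0 1) := by
  have hsq : ∀ k ∈ Ioo (0 : ℝ) 1, k ^ 2 < 1 := fun _ => sq_lt_one_of_mem_Ioo
  refine ContinuousOn.congr (ContinuousOn.div ?_ (continuousOn_ellipticK.mono hsq)
    fun k hk => (ellipticK_pos (hsq k hk)).ne') fun k hk =>
      phi_eq_ellipticF_div_ellipticK (hsq k hk)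
  exact continuousOn_ellipticF_comp continuousOn_id
    (continuousOn_crossingAngle.mono fun _ hk => hk.1.ne') hsq

lemma tendsto_phi_nhdsGT : Tendsto phi (𝓝[>] (1 / √2)) (𝓝 1) := by
  have hphi : phi (1 / √2) = 1 := by
    have hk := sq_lt_one_of_mem_Ioo one_div_sqrt_two_mem_Ioo
    have hangle : crossingAngle (1 / √2) = π / 2 := by
      rw [crossingAngle, sq_one_div_sqrt_two]
      norm_num
    rw [phi_eq_ellipticF_div_ellipticK hk, hangle, ← ellipticK_eq_ellipticF,
      div_self (ellipticK_pos hk).ne']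
  have hcont := (continuousOn_phi.continuousAt
    (isOpen_Ioo.mem_nhds one_div_sqrt_two_mem_Ioo)).tendsto
  rw [hphi] at hcont
  exact hcont.mono_left nhdsWithin_le_nhds

lemma ellipticF_crossingAngle_le_pi (hk : k ∈ moduli) : ellipticF k (crossingAngle k) ≤ π := by
  have hk₁ := sq_lt_one_of_mem_moduli hk
  obtain ⟨hθ₀, hθ⟩ := crossingAngle_mem_Icc k
  have hhalf : 1 / 2 ≤ k := by nlinarith [pos_of_mem_moduli hk, two_mul_sq_sub_one_pos hk]
  have hle : ∀ θ ∈ Icc 0 (crossingAngle k), 1 / legendreDelta k θ ≤ 2 := fun θ hθ' => by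
    have hanti : k ≤ legendreDelta k θ := by
      refine (legendreDelta_crossingAngle hk).symm.trans_le (sqrt_le_sqrt ?_)
      gcongr 1 - k ^ 2 * ?_
      exact sin_sq_le_sin_sq hθ'.1 hθ'.2 hθ
    rw [div_le_iff₀ (legendreDelta_pos hk₁ θ)]
    linarith
  have hmono := intervalIntegral.integral_mono_on hθ₀
    (intervalIntegrable_one_div_legendreDelta hk₁ _ _) intervalIntegrable_const hle
  rw [← ellipticF_sub hk₁, ellipticF_zero, intervalIntegral.integral_const, smul_eq_mul] at hmono
  linarith

lemma tendsto_phi_nhdsLT : Tendsto phi (𝓝[<] 1) (𝓝 0) := by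
  refine tendsto_of_tendsto_of_tendsto_of_le_of_le' tendsto_const_nhds
    (tendsto_ellipticK_atTop.const_div_atTop π) ?_ ?_
  · filter_upwards [moduli_mem_nhdsLT] with k hk using (phi_mem_Ioo hk).1.le
  · filter_upwards [moduli_mem_nhdsLT] with k hk
    have hk₁ := sq_lt_one_of_mem_moduli hk
    rw [phi_eq_ellipticF_div_ellipticK hk₁]
    exact div_le_div_of_nonneg_right (ellipticF_crossingAngle_le_pi hk) (ellipticK_pos hk₁).le

lemma bijOn_phi : BijOn phi moduli (Ioo 0 1) :=
  ⟨fun _ => phi_mem_Ioo, strictAntiOn_phi.injOn,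
    isPreconnected_Ioo.intermediate_value_Ioo (le_principal_iff.2 moduli_mem_nhdsLT)
      (le_principal_iff.2 moduli_mem_nhdsGT) (continuousOn_phi.mono moduli_subset_Ioo)
      tendsto_phi_nhdsLT tendsto_phi_nhdsGT⟩

lemma SInv_S (hk : k ∈ moduli) : SInv (S k) = k :=
  bijOn_S.injOn.leftInvOn_invFunOn hk

lemma phiInv_mem_moduli {y : ℝ} (hy : y ∈ Ioo 0 1) : phiInv y ∈ moduli :=
  bijOn_phi.surjOn.mapsTo_invFunOn hy

lemma phi_phiInv {y : ℝ} (hy : y ∈ Ioo 0 1) : phi (phiInv y) = y :=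
  bijOn_phi.surjOn.rightInvOn_invFunOn hy

lemma phiInv_phi (hk : k ∈ moduli) : phiInv (phi k) = k :=
  bijOn_phi.injOn.leftInvOn_invFunOn hk

lemma G_pos {y : ℝ} (hy : y ∈ Ioo 0 1) : 0 < G y :=
  S_pos (phiInv_mem_moduli hy)

end Moduli

section JacobiFunctions

variable {k : ℝ}

/-- The Jacobi function `sn(x; k)`, with the argument convention of `jacobiCn`. -/
noncomputable def jacobiSn (x k : ℝ) : ℝ :=
  sin (jacobiAm x k)

/-- The Jacobi function `dn(x; k)`, with the argument convention of `jacobiCn`. -/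
noncomputable def jacobiDn (x k : ℝ) : ℝ :=
  legendreDelta k (jacobiAm x k)

lemma ellipticF_jacobiAm (hk : k ^ 2 < 1) (x : ℝ) : ellipticF k (jacobiAm x k) = x :=
  Function.rightInverse_invFun (surjective_ellipticF hk) x

lemma jacobiAm_ellipticF (hk : k ^ 2 < 1) (a : ℝ) : jacobiAm (ellipticF k a) k = a :=
  Function.leftInverse_invFun (strictMono_ellipticF hk).injective a

lemma jacobiAm_eq_iff (hk : k ^ 2 < 1) {x a : ℝ} : jacobiAm x k = a ↔ x = ellipticF k a := by
  rw [← (strictMono_ellipticF hk).injective.eq_iff, ellipticF_jacobiAm hk]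

lemma continuous_jacobiAm (hk : k ^ 2 < 1) : Continuous fun x => jacobiAm x k := by
  let e := (strictMono_ellipticF hk).orderIsoOfSurjective _ (surjective_ellipticF hk)
  have he : (fun x => jacobiAm x k) = e.symm := funext fun x =>
    (jacobiAm_eq_iff hk).2 (e.apply_symm_apply x).symm
  exact he ▸ e.symm.continuous

lemma hasDerivAt_jacobiAm (hk : k ^ 2 < 1) (x : ℝ) :
    HasDerivAt (fun x => jacobiAm x k) (jacobiDn x k) x := by
  have h := (hasDerivAt_ellipticF hk (jacobiAm x k)).of_local_left_inverse
    (continuous_jacobiAm hk).continuousAt (one_div_pos.2 (legendreDelta_pos hk _)).ne'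
    (Eventually.of_forall (ellipticF_jacobiAm hk))
  exact h.congr_deriv (by rw [one_div, inv_inv, jacobiDn])

lemma jacobiSn_sq_add_jacobiCn_sq (x k : ℝ) : jacobiSn x k ^ 2 + jacobiCn x k ^ 2 = 1 :=
  sin_sq_add_cos_sq _

lemma jacobiDn_pos (hk : k ^ 2 < 1) (x : ℝ) : 0 < jacobiDn x k :=
  legendreDelta_pos hk _

lemma jacobiDn_sq (hk : k ^ 2 < 1) (x : ℝ) : jacobiDn x k ^ 2 = 1 - k ^ 2 * jacobiSn x k ^ 2 :=
  legendreDelta_sq hk _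

lemma hasDerivAt_jacobiSn (hk : k ^ 2 < 1) (x : ℝ) :
    HasDerivAt (fun x => jacobiSn x k) (jacobiCn x k * jacobiDn x k) x :=
  (hasDerivAt_jacobiAm hk x).sin

lemma hasDerivAt_jacobiCn (hk : k ^ 2 < 1) (x : ℝ) :
    HasDerivAt (fun x => jacobiCn x k) (-jacobiSn x k * jacobiDn x k) x :=
  (hasDerivAt_jacobiAm hk x).cos

lemma hasDerivAt_jacobiDn (hk : k ^ 2 < 1) (x : ℝ) :
    HasDerivAt (fun x => jacobiDn x k) (-k ^ 2 * jacobiSn x k * jacobiCn x k) x := by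
  have h := (((hasDerivAt_jacobiSn hk x).fun_pow 2).const_mul (k ^ 2)).const_sub 1
  refine (h.sqrt (one_sub_mul_sin_sq_pos hk _).ne').congr_deriv ?_
  change _ / (2 * jacobiDn x k) = _
  field_simp [(jacobiDn_pos hk x).ne']
  norm_num
  ring

lemma hasDerivAt_neg_jacobiSn_mul_jacobiDn (hk : k ^ 2 < 1) (x : ℝ) :
    HasDerivAt (fun x => -jacobiSn x k * jacobiDn x k)
      ((2 * k ^ 2 - 1) * jacobiCn x k - 2 * k ^ 2 * jacobiCn x k ^ 3) x := by
  refine ((hasDerivAt_jacobiSn hk x).fun_neg.fun_mul (hasDerivAt_jacobiDn hk x)).congr_deriv ?_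
  linear_combination -jacobiCn x k * jacobiDn_sq hk x +
    2 * k ^ 2 * jacobiCn x k * jacobiSn_sq_add_jacobiCn_sq x k

lemma jacobiAm_neg (hk : k ^ 2 < 1) (x : ℝ) : jacobiAm (-x) k = -jacobiAm x k := by
  rw [jacobiAm_eq_iff hk, ellipticF_neg, ellipticF_jacobiAm hk]

lemma jacobiAm_add_int_mul (hk : k ^ 2 < 1) (x : ℝ) (m : ℤ) :
    jacobiAm (x + 2 * ellipticK k * m) k = jacobiAm x k + m * π := by
  rw [jacobiAm_eq_iff hk, ellipticF_add_int_mul_pi hk, ellipticF_jacobiAm hk]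

lemma jacobiCn_antiperiodic (hk : k ^ 2 < 1) :
    Function.Antiperiodic (fun x => jacobiCn x k) (2 * ellipticK k) := fun x => by
  have h := jacobiAm_add_int_mul hk x 1
  rw [Int.cast_one, mul_one, one_mul] at h
  simp only [jacobiCn, h, cos_add_pi]

lemma jacobiAm_injective (hk : k ^ 2 < 1) : Function.Injective fun x => jacobiAm x k :=
  Function.LeftInverse.injective (ellipticF_jacobiAm hk)

lemma jacobiCn_eq_iff (hk : k ^ 2 < 1) {x y : ℝ} :
    jacobiCn x k = jacobiCn y k ↔
      ∃ m : ℤ, y = 4 * ellipticK k * m + x ∨ y = 4 * ellipticK k * m - x := by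
  have hshift (z : ℝ) (m : ℤ) :
      jacobiAm (4 * ellipticK k * m + z) k = 2 * m * π + jacobiAm z k := by
    have h := jacobiAm_add_int_mul hk z (2 * m)
    push_cast at h
    rw [add_comm (2 * m * π), ← h]
    ring_nf
  rw [jacobiCn, jacobiCn, cos_eq_cos_iff]
  refine exists_congr fun m => or_congr ?_ ?_
  · rw [← (jacobiAm_injective hk).eq_iff (a := y), hshift]
  · rw [← (jacobiAm_injective hk).eq_iff (a := y), sub_eq_add_neg (4 * _ * _), hshift,
      jacobiAm_neg hk, sub_eq_add_neg]

lemma periodic_jacobiCn_iff (hk : k ^ 2 < 1) {T : ℝ} :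
    Function.Periodic (fun x => jacobiCn x k) T ↔ ∃ m : ℤ, T = 4 * ellipticK k * m := by
  refine ⟨fun h => ?_, ?_⟩
  · have h₀ := h 0
    rw [zero_add] at h₀
    simpa only [add_zero, sub_zero, or_self] using (jacobiCn_eq_iff hk).1 h₀.symm
  · rintro ⟨m, rfl⟩ x
    exact ((jacobiCn_eq_iff hk).2 ⟨m, Or.inl (add_comm _ _)⟩).symm

lemma exists_int_eq_of_jacobiCn_eq {x y : ℝ} (hk : k ^ 2 < 1) (hcn : jacobiCn x k = jacobiCn y k)
    (hsn : -jacobiSn x k * jacobiDn x k = -jacobiSn y k * jacobiDn y k) :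
    ∃ m : ℤ, y = x + 4 * ellipticK k * m := by
  have hsn_sq : jacobiSn x k ^ 2 = jacobiSn y k ^ 2 := by
    linear_combination jacobiSn_sq_add_jacobiCn_sq x k - jacobiSn_sq_add_jacobiCn_sq y k -
      (jacobiCn x k + jacobiCn y k) * hcn
  have hdn : jacobiDn x k = jacobiDn y k := by
    simp only [jacobiSn] at hsn_sq
    simp only [jacobiDn, legendreDelta, hsn_sq]
  rw [hdn] at hsn
  have hsin := neg_injective (mul_right_cancel₀ (jacobiDn_pos hk y).ne' hsn)
  obtain ⟨m, hm⟩ := (Angle.angle_eq_iff_two_pi_dvd_sub).1 (Angle.cos_sin_inj hcn.symm hsin.symm)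
  refine ⟨m, jacobiAm_injective hk ?_⟩
  have h := jacobiAm_add_int_mul hk x (2 * m)
  push_cast at h
  rw [show x + 4 * ellipticK k * m = x + 2 * ellipticK k * (2 * m) by ring]
  simp only [h]
  linarith

end JacobiFunctions

section Waves

/-- The vector field of the phase plane `(u, u')` of the equation `u'' = w u - u³`. -/
def cubicField (w : ℝ) (p : ℝ × ℝ) : ℝ × ℝ :=
  (p.2, w * p.1 - p.1 ^ 3)

/-- The cnoidal wave of wave number `b`, modulus `k` and shift `s`; its amplitude is the one for
which it solves `u'' = w u - u³` for some `w`, namely `w = b² (2k² - 1)`. -/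
noncomputable def cnWave (b k s x : ℝ) : ℝ :=
  √2 * k * b * jacobiCn (b * (x - s)) k

/-- The derivative of the cnoidal wave `cnWave b k s`. -/
noncomputable def cnWaveDeriv (b k s x : ℝ) : ℝ :=
  √2 * k * b ^ 2 * (-jacobiSn (b * (x - s)) k * jacobiDn (b * (x - s)) k)

/-- The homoclinic solution of `u'' = a² u - u³` with its maximum at `0`. -/
noncomputable def soliton (a x : ℝ) : ℝ :=
  √2 * a / cosh (a * x)

/-- The derivative of `soliton a`. -/
noncomputable def solitonDeriv (a x : ℝ) : ℝ :=
  -(√2 * a ^ 2 * sinh (a * x)) / cosh (a * x) ^ 2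

variable {b k s w x : ℝ}

lemma hasDerivAt_cnWave (hk : k ^ 2 < 1) :
    HasDerivAt (cnWave b k s) (cnWaveDeriv b k s x) x := by
  have hphase := ((hasDerivAt_id x).sub_const s).const_mul b
  refine (((hasDerivAt_jacobiCn hk _).comp x hphase).const_mul (√2 * k * b)).congr_deriv ?_
  simp only [cnWaveDeriv, id_eq]
  ring

lemma hasDerivAt_cnWaveDeriv (hk : k ^ 2 < 1) :
    HasDerivAt (cnWaveDeriv b k s)
      (b ^ 2 * (2 * k ^ 2 - 1) * cnWave b k s x - cnWave b k s x ^ 3) x := by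
  have hphase := ((hasDerivAt_id x).sub_const s).const_mul b
  refine (((hasDerivAt_neg_jacobiSn_mul_jacobiDn hk _).comp x hphase).const_mul
    (√2 * k * b ^ 2)).congr_deriv ?_
  simp only [cnWave, id_eq]
  linear_combination √2 * k ^ 3 * b ^ 3 * jacobiCn (b * (x - s)) k ^ 3 *
    sq_sqrt (zero_le_two (α := ℝ))

lemma hasDerivAt_cnWave_orbit (hk : k ^ 2 < 1) (hw : b ^ 2 * (2 * k ^ 2 - 1) = w) :
    HasDerivAt (fun x => (cnWave b k s x, cnWaveDeriv b k s x))
      (cubicField w (cnWave b k s x, cnWaveDeriv b k s x)) x :=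
  hw ▸ (hasDerivAt_cnWave hk).prodMk (hasDerivAt_cnWaveDeriv hk)

lemma periodic_cnWave_iff (hb : b ≠ 0) (hk₀ : k ≠ 0) (hk : k ^ 2 < 1) {T : ℝ} :
    Function.Periodic (cnWave b k s) T ↔ ∃ m : ℤ, b * T = 4 * ellipticK k * m := by
  rw [← periodic_jacobiCn_iff hk]
  have hamp : √2 * k * b ≠ 0 := by positivity
  refine ⟨fun h y => ?_, fun h x => ?_⟩
  · have h := mul_left_cancel₀ hamp (h (y / b + s))
    rwa [add_sub_cancel_right, mul_div_cancel₀ y hb, add_right_comm, add_sub_cancel_right,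
      mul_add, mul_div_cancel₀ y hb] at h
  · have h := h (b * (x - s))
    rw [← mul_add, ← add_sub_right_comm] at h
    simp only [cnWave, h]

lemma isLeast_period_cnWave (hb : 0 < b) (hk₀ : k ≠ 0) (hk : k ^ 2 < 1) :
    IsLeast {T : ℝ | 0 < T ∧ Function.Periodic (cnWave b k s) T} (4 * ellipticK k / b) := by
  have hK := ellipticK_pos hk
  refine ⟨⟨by positivity, (periodic_cnWave_iff hb.ne' hk₀ hk).2 ⟨1, ?_⟩⟩, ?_⟩
  · rw [mul_div_cancel₀ _ hb.ne', Int.cast_one, mul_one]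
  · rintro T ⟨hT, hper⟩
    obtain ⟨m, hm⟩ := (periodic_cnWave_iff hb.ne' hk₀ hk).1 hper
    have hm₀ : (0 : ℝ) < m := pos_of_mul_pos_right (hm ▸ mul_pos hb hT) (by positivity)
    have hm₁ : (1 : ℝ) ≤ m := by exact_mod_cast hm₀
    rw [div_le_iff₀' hb, hm]
    exact le_mul_of_one_le_right (by positivity) hm₁

lemma exists_nat_of_cnWave_orbit_eq (hb : 0 < b) (hk₀ : k ≠ 0) (hk : k ^ 2 < 1) {x y : ℝ}
    (hxy : x < y) (h : cnWave b k s x = cnWave b k s y)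
    (h' : cnWaveDeriv b k s x = cnWaveDeriv b k s y) :
    ∃ n : ℕ, 1 ≤ n ∧ b = 4 * ellipticK k * n / (y - x) := by
  have hcn := mul_left_cancel₀ (by positivity) h
  have hsn := mul_left_cancel₀ (by positivity) h'
  obtain ⟨m, hm⟩ := exists_int_eq_of_jacobiCn_eq hk hcn hsn
  have hK := ellipticK_pos hk
  have hm' : b * (y - x) = 4 * ellipticK k * m := by linear_combination hm
  have hm₀ : (0 : ℝ) < m :=
    pos_of_mul_pos_right (hm' ▸ mul_pos hb (sub_pos.2 hxy)) (by positivity)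
  lift m to ℕ using by exact_mod_cast hm₀.le
  exact ⟨m, by exact_mod_cast hm₀, eq_div_of_mul_eq (sub_pos.2 hxy).ne' hm'⟩

lemma jacobiCn_ellipticK_mul_phi (hk : k ^ 2 < 1) :
    jacobiCn (ellipticK k * phi k) k = √((2 * k ^ 2 - 1) / k ^ 2) := by
  rw [phi_eq_ellipticF_div_ellipticK hk, mul_div_cancel₀ _ (ellipticK_pos hk).ne', jacobiCn,
    jacobiAm_ellipticF hk, cos_crossingAngle hk]

lemma cnWave_eq_sqrt_iff (hb : 0 < b) (hk : k ∈ moduli) (hw : b ^ 2 * (2 * k ^ 2 - 1) = w) :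
    cnWave b k s x = √(2 * w) ↔
      jacobiCn (b * (x - s)) k = jacobiCn (ellipticK k * phi k) k := by
  have hk₀ := pos_of_mem_moduli hk
  have hlevel : √(2 * w) = √2 * k * b * √((2 * k ^ 2 - 1) / k ^ 2) := by
    rw [← hw, sqrt_mul zero_le_two, sqrt_mul (sq_nonneg b), sqrt_sq hb.le,
      sqrt_div' _ (sq_nonneg k), sqrt_sq hk₀.le]
    field_simp
  rw [jacobiCn_ellipticK_mul_phi (sq_lt_one_of_mem_moduli hk), hlevel, cnWave]
  exact mul_right_inj' (by positivity)

lemma cnWaveDeriv_sq_of_eq_sqrt (hb : 0 < b) (hk : k ∈ moduli)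
    (hw : b ^ 2 * (2 * k ^ 2 - 1) = w) (h : cnWave b k s x = √(2 * w)) :
    cnWaveDeriv b k s x ^ 2 = 2 * b ^ 4 * (k ^ 2 * (1 - k ^ 2)) := by
  have hk₁ := sq_lt_one_of_mem_moduli hk
  have hcn : k ^ 2 * jacobiCn (b * (x - s)) k ^ 2 = 2 * k ^ 2 - 1 := by
    rw [(cnWave_eq_sqrt_iff hb hk hw).1 h, jacobiCn_ellipticK_mul_phi hk₁,
      sq_sqrt (div_nonneg (two_mul_sq_sub_one_pos hk).le (sq_nonneg k)),
      mul_div_cancel₀ _ (pow_pos (pos_of_mem_moduli hk) 2).ne']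
  have hsn : k ^ 2 * jacobiSn (b * (x - s)) k ^ 2 = 1 - k ^ 2 := by
    linear_combination k ^ 2 * jacobiSn_sq_add_jacobiCn_sq (b * (x - s)) k - hcn
  have hdn : jacobiDn (b * (x - s)) k ^ 2 = k ^ 2 := by
    linear_combination jacobiDn_sq hk₁ (b * (x - s)) - hsn
  simp only [cnWaveDeriv, mul_pow, neg_sq, hdn, sq_sqrt (zero_le_two (α := ℝ))]
  linear_combination 2 * b ^ 4 * k ^ 2 * hsn

lemma cnWave_neg_zero (hk : k ^ 2 < 1) : cnWave b k (-s) 0 = cnWave b k s 0 := by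
  simp only [cnWave, jacobiCn, zero_sub, mul_neg, jacobiAm_neg hk, cos_neg]

lemma cnWaveDeriv_neg_zero (hk : k ^ 2 < 1) : cnWaveDeriv b k (-s) 0 = -cnWaveDeriv b k s 0 := by
  simp only [cnWaveDeriv, jacobiSn, jacobiDn, legendreDelta, zero_sub, mul_neg, jacobiAm_neg hk,
    sin_neg, neg_sq, neg_neg, neg_mul]

lemma exists_waveNumber_modulus (hw : 0 < w) {p : ℝ} (hp : p ≠ 0) :
    ∃ b > 0, ∃ k ∈ moduli, b ^ 2 * (2 * k ^ 2 - 1) = w ∧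
      2 * b ^ 4 * (k ^ 2 * (1 - k ^ 2)) = p ^ 2 := by
  obtain ⟨B, hB₀, hB⟩ : ∃ B > 0, B ^ 2 = w ^ 2 + 2 * p ^ 2 :=
    ⟨√(w ^ 2 + 2 * p ^ 2), by positivity, sq_sqrt (by positivity)⟩
  have hwB : w / B < 1 := by
    have hp₂ := sq_pos_of_ne_zero hp
    exact (div_lt_one hB₀).2 (lt_of_pow_lt_pow_left₀ 2 hB₀.le (by linarith))
  have hwB₀ : 0 < w / B := by positivity
  have hk : √((1 + w / B) / 2) ^ 2 = (1 + w / B) / 2 := sq_sqrt (by positivity)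
  refine ⟨√B, by positivity, √((1 + w / B) / 2), mem_moduli_of_sq_mem (by positivity) ?_, ?_, ?_⟩
  · rw [hk]
    constructor <;> linarith
  · rw [hk, sq_sqrt hB₀.le]
    field_simp
    ring
  · rw [hk, show √B ^ 4 = (√B ^ 2) ^ 2 by ring, sq_sqrt hB₀.le]
    field_simp
    linear_combination hB

lemma exists_cnWave_initial (hw : 0 < w) {p : ℝ} (hp : p ≠ 0) :
    ∃ b > 0, ∃ k ∈ moduli, ∃ s, b ^ 2 * (2 * k ^ 2 - 1) = w ∧
      cnWave b k s 0 = √(2 * w) ∧ cnWaveDeriv b k s 0 = p := by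
  obtain ⟨b, hb, k, hk, hbw, hbp⟩ := exists_waveNumber_modulus hw hp
  have hk₁ := sq_lt_one_of_mem_moduli hk
  obtain ⟨s, hs⟩ : ∃ s, cnWave b k s 0 = √(2 * w) := by
    refine ⟨-(ellipticK k * phi k / b), (cnWave_eq_sqrt_iff hb hk hbw).2 ?_⟩
    rw [zero_sub, neg_neg, mul_div_cancel₀ _ hb.ne']
  rcases sq_eq_sq_iff_eq_or_eq_neg.1 ((cnWaveDeriv_sq_of_eq_sqrt hb hk hbw hs).trans hbp) with h | h
  · exact ⟨b, hb, k, hk, s, hbw, hs, h⟩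
  · exact ⟨b, hb, k, hk, -s, hbw, by rw [cnWave_neg_zero hk₁, hs],
      by rw [cnWaveDeriv_neg_zero hk₁, h, neg_neg]⟩

lemma hasDerivAt_soliton (a x : ℝ) : HasDerivAt (soliton a) (solitonDeriv a x) x := by
  have hcosh := ((hasDerivAt_id x).const_mul a).cosh
  refine ((hasDerivAt_const x (√2 * a)).fun_div hcosh (cosh_pos _).ne').congr_deriv ?_
  simp only [solitonDeriv, id_eq]
  ring

lemma hasDerivAt_solitonDeriv (a x : ℝ) :
    HasDerivAt (solitonDeriv a) (a ^ 2 * soliton a x - soliton a x ^ 3) x := by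
  have hphase := (hasDerivAt_id x).const_mul a
  have h := (hphase.sinh.const_mul (√2 * a ^ 2)).fun_neg.fun_div (hphase.cosh.fun_pow 2)
    (pow_pos (cosh_pos _) 2).ne'
  have hc := (cosh_pos (a * x)).ne'
  refine h.congr_deriv ?_
  simp only [soliton, id_eq]
  field_simp
  have h2 : √2 ^ 2 = 2 := sq_sqrt zero_le_two
  push_cast
  linear_combination a ^ 3 * cosh (a * x) * h2 -
    2 * a ^ 3 * cosh (a * x) * cosh_sq_sub_sinh_sq (a * x)

lemma hasDerivAt_soliton_orbit (hw : 0 ≤ w) (x : ℝ) :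
    HasDerivAt (fun x => (soliton √w x, solitonDeriv √w x))
      (cubicField w (soliton √w x, solitonDeriv √w x)) x := by
  have h := hasDerivAt_solitonDeriv √w x
  rw [sq_sqrt hw] at h
  exact (hasDerivAt_soliton _ x).prodMk h

lemma soliton_lt_soliton_zero {a : ℝ} (ha : 0 < a) (hx : x ≠ 0) : soliton a x < soliton a 0 := by
  rw [soliton, soliton, mul_zero, cosh_zero]
  exact div_lt_div_of_pos_left (by positivity) one_pos (one_lt_cosh.2 (mul_ne_zero ha.ne' hx))

end Waves

section CauchyProblem

lemma eqOn_Icc_of_locallyLipschitz {E : Type*} [NormedAddCommGroup E] [NormedSpace ℝ E]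
    {V : E → E} (hV : LocallyLipschitz V) {f g : ℝ → E} {a b : ℝ}
    (hf : ∀ x ∈ Icc a b, HasDerivWithinAt f (V (f x)) (Icc a b) x)
    (hg : ∀ x ∈ Icc a b, HasDerivWithinAt g (V (g x)) (Icc a b) x) (h : f a = g a) :
    EqOn f g (Icc a b) := by
  have hfc : ContinuousOn f (Icc a b) := fun x hx => (hf x hx).continuousWithinAt
  have hgc : ContinuousOn g (Icc a b) := fun x hx => (hg x hx).continuousWithinAt
  obtain ⟨K, hK⟩ := hV.locallyLipschitzOn.exists_lipschitzOnWith_of_compact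
    ((isCompact_Icc.image_of_continuousOn hfc).union (isCompact_Icc.image_of_continuousOn hgc))
  have hmem : ∀ x ∈ Ico a b, Icc a b ∈ 𝓝[≥] x := fun x hx =>
    mem_of_superset (Icc_mem_nhdsGE hx.2) (Icc_subset_Icc_left hx.1)
  have hsub : Ico a b ⊆ Icc a b := Ico_subset_Icc_self
  exact ODE_solution_unique_of_mem_Icc_right (v := fun _ => V) (fun _ _ => hK)
    hfc (fun x hx => (hf x (hsub hx)).mono_of_mem_nhdsWithin (hmem x hx))
    (fun x hx => Or.inl (mem_image_of_mem f (hsub hx)))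
    hgc (fun x hx => (hg x (hsub hx)).mono_of_mem_nhdsWithin (hmem x hx))
    (fun x hx => Or.inr (mem_image_of_mem g (hsub hx))) h

lemma locallyLipschitz_cubicField (w : ℝ) : LocallyLipschitz (cubicField w) := by
  have h : ContDiff ℝ 1 (cubicField w) := by
    unfold cubicField
    fun_prop
  exact h.locallyLipschitz

end CauchyProblem

section WeakDerivatives

/-- `η` is a smooth function with compact support contained in `U`. -/
structure IsTestFunction (U : Set ℝ) (η : ℝ → ℝ) : Prop where
  contDiff : ContDiff ℝ ((⊤ : ℕ∞) : WithTop ℕ∞) η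
  hasCompactSupport : HasCompactSupport η
  tsupport_subset : tsupport η ⊆ U

variable {U : Set ℝ} {η ζ f g h : ℝ → ℝ} {L : ℝ}

namespace IsTestFunction

lemma eq_zero_of_notMem (hη : IsTestFunction U η) {x : ℝ} (hx : x ∉ U) : η x = 0 :=
  image_eq_zero_of_notMem_tsupport fun h => hx (hη.tsupport_subset h)

lemma integrable (hη : IsTestFunction U η) : Integrable η :=
  hη.contDiff.continuous.integrable_of_hasCompactSupport hη.hasCompactSupport

lemma sub_const_mul (hη : IsTestFunction U η) (hζ : IsTestFunction U ζ) (c : ℝ) :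
    IsTestFunction U fun x => η x - c * ζ x where
  contDiff := hη.contDiff.sub (contDiff_const.mul hζ.contDiff)
  hasCompactSupport := hη.hasCompactSupport.sub (hζ.hasCompactSupport.mul_left (f := fun _ => c))
  tsupport_subset := (tsupport_sub _ _).trans (union_subset hη.tsupport_subset
    (tsupport_mul_subset_right.trans hζ.tsupport_subset))

protected lemma deriv (hη : IsTestFunction U η) : IsTestFunction U (deriv η) where
  contDiff := (contDiff_infty_iff_deriv.1 hη.contDiff).2
  hasCompactSupport := hη.hasCompactSupport.deriv
  tsupport_subset := tsupport_deriv_subset.trans hη.tsupport_subset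

lemma setIntegral_mul (hη : IsTestFunction U η) (f : ℝ → ℝ) :
    ∫ x in U, f x * η x = ∫ x, f x * η x :=
  setIntegral_eq_integral_of_forall_compl_eq_zero fun x hx => by
    rw [hη.eq_zero_of_notMem hx, mul_zero]

lemma integrable_mul (hη : IsTestFunction U η) (hf : LocallyIntegrableOn f U) :
    Integrable fun x => f x * η x := by
  have hK : IsCompact (tsupport η) := hη.hasCompactSupport
  have hfη := (hf.integrableOn_compact_subset hη.tsupport_subset hK).mul_continuousOn
    hη.contDiff.continuous.continuousOn hK
  refine hfη.integrable_of_forall_notMem_eq_zero fun x hx => ?_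
  rw [image_eq_zero_of_notMem_tsupport hx, mul_zero]

end IsTestFunction

lemma exists_isTestFunction_integral_eq_one (hU : IsOpen U) (hne : U.Nonempty) :
    ∃ η, IsTestFunction U η ∧ ∫ x, η x = 1 := by
  obtain ⟨c, hc⟩ := hne
  obtain ⟨R, hR, hsub⟩ := Metric.nhds_basis_closedBall.mem_iff.1 (hU.mem_nhds hc)
  let bump : ContDiffBump c := ⟨R / 2, R, half_pos hR, half_lt_self hR⟩
  exact ⟨bump.normed volume, ⟨bump.contDiff_normed, bump.hasCompactSupport_normed,
    bump.tsupport_normed_eq.trans_subset hsub⟩, bump.integral_normed⟩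

lemma exists_Icc_subset_of_isCompact [OrdConnected U] {K : Set ℝ} (hK : IsCompact K)
    (hKU : K ⊆ U) : ∃ a b, K ⊆ Icc a b ∧ Icc a b ⊆ U := by
  rcases K.eq_empty_or_nonempty with rfl | hne
  · exact ⟨1, 0, empty_subset _, by simp⟩
  · exact ⟨sInf K, sSup K, hK.isBounded.subset_Icc_sInf_sSup,
      U.Icc_subset (hKU (hK.sInf_mem hne)) (hKU (hK.sSup_mem hne))⟩

lemma IsTestFunction.exists_deriv_eq [OrdConnected U] (hη : IsTestFunction U η)
    (hint : ∫ x, η x = 0) : ∃ ζ, IsTestFunction U ζ ∧ deriv ζ = η := by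
  obtain ⟨a, b, hab, habU⟩ :=
    exists_Icc_subset_of_isCompact hη.hasCompactSupport hη.tsupport_subset
  have hzero : ∀ x ∉ Icc a b, η x = 0 := fun x hx =>
    image_eq_zero_of_notMem_tsupport fun h => hx (hab h)
  let ζ : ℝ → ℝ := fun x => ∫ t in a..x, η t
  have hζ : ∀ x, HasDerivAt ζ (η x) x := fun x =>
    (hη.contDiff.continuous.integral_hasStrictDerivAt a x).hasDerivAt
  have hderiv : deriv ζ = η := funext fun x => (hζ x).deriv
  have hsupp : Function.support ζ ⊆ Icc a b := by
    refine Function.support_subset_iff'.2 fun x hx => ?_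
    rcases lt_or_ge x a with hxa | hax
    · refine intervalIntegral.integral_zero_ae ?_
      filter_upwards [Measure.ae_ne volume a] with t hta ht
      rw [uIoc_of_ge hxa.le] at ht
      exact hzero t fun h => hta (ht.2.antisymm h.1)
    · have hbx : b < x := not_le.1 fun h => hx ⟨hax, h⟩
      simp only [ζ]
      rw [intervalIntegral.integral_of_le hax, ← integral_Icc_eq_integral_Ioc, ← hint]
      exact setIntegral_eq_integral_of_forall_compl_eq_zero fun t ht =>
        hzero t fun h => ht ⟨h.1, h.2.trans hbx.le⟩
  exact ⟨ζ, ⟨contDiff_infty_iff_deriv.2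
    ⟨fun x => (hζ x).differentiableAt, hderiv ▸ hη.contDiff⟩,
    HasCompactSupport.of_support_subset_isCompact isCompact_Icc hsupp,
    (closure_minimal hsupp isClosed_Icc).trans habU⟩, hderiv⟩

lemma ae_eq_const_of_integral_mul_deriv_eq_zero [OrdConnected U] (hU : IsOpen U)
    (hne : U.Nonempty) (hh : LocallyIntegrableOn h U)
    (hint : ∀ η, IsTestFunction U η → ∫ x in U, h x * deriv η x = 0) :
    ∃ c, ∀ᵐ x, x ∈ U → h x = c := by
  obtain ⟨ρ, hρ, hρ₁⟩ := exists_isTestFunction_integral_eq_one hU hne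
  have hmean (ζ : ℝ → ℝ) (hζ : IsTestFunction U ζ) :
      ∫ x, h x * ζ x = (∫ x, ζ x) * ∫ x, h x * ρ x := by
    have hψ := hζ.sub_const_mul hρ (∫ x, ζ x)
    obtain ⟨η, hη, hηψ⟩ := hψ.exists_deriv_eq <| by
      rw [integral_sub hζ.integrable (hρ.integrable.const_mul _), integral_const_mul, hρ₁,
        mul_one, sub_self]
    have h₀ := hint η hη
    rw [hηψ, hψ.setIntegral_mul h] at h₀
    simp only [mul_sub, mul_left_comm (h _)] at h₀
    rwa [integral_sub (hζ.integrable_mul hh) ((hρ.integrable_mul hh).const_mul _),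
      integral_const_mul, sub_eq_zero] at h₀
  refine ⟨∫ x, h x * ρ x, ?_⟩
  have hloc : LocallyIntegrableOn (fun x => h x - ∫ x, h x * ρ x) U :=
    hh.sub (locallyIntegrableOn_const _)
  have hae := hU.ae_eq_zero_of_integral_contDiff_smul_eq_zero hloc fun ζ hζ hζc hζU => by
    have hζ' : IsTestFunction U ζ := ⟨hζ, hζc, hζU⟩
    simp only [smul_eq_mul, mul_sub, mul_comm (ζ _) (h _)]
    rw [integral_sub (hζ'.integrable_mul hh) (hζ'.integrable.mul_const _), integral_mul_const,
      hmean ζ hζ', sub_self]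
  filter_upwards [hae] with x hx hxU
  exact sub_eq_zero.1 (hx hxU)

lemma hasWeakDeriv_of_hasDerivAt (hL : 0 ≤ L) (hf : ∀ x, HasDerivAt f (g x) x)
    (hg : Continuous g) : HasWeakDeriv L f g := by
  intro η hη hηc hηs
  have hη' : IsTestFunction (Ioo 0 L) η := ⟨hη, hηc, hηs⟩
  have hparts := intervalIntegral.integral_mul_deriv_eq_deriv_mul (a := 0) (b := L)
    (fun x _ => hf x) (fun x _ => (hη.differentiable (by simp) x).hasDerivAt)
    (hg.intervalIntegrable _ _) (hη'.deriv.contDiff.continuous.intervalIntegrable _ _)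
  rwa [hη'.eq_zero_of_notMem left_notMem_Ioo, hη'.eq_zero_of_notMem right_notMem_Ioo, mul_zero,
    mul_zero, sub_zero, zero_sub, intervalIntegral.integral_of_le hL,
    intervalIntegral.integral_of_le hL, integral_Ioc_eq_integral_Ioo,
    integral_Ioc_eq_integral_Ioo] at hparts

lemma HasWeakDeriv.hasDerivWithinAt (hL : 0 < L) (h : HasWeakDeriv L f g)
    (hf : ContinuousOn f (Icc 0 L)) (hg : ContinuousOn g (Icc 0 L)) {x : ℝ} (hx : x ∈ Icc 0 L) :
    HasDerivWithinAt f (g x) (Icc 0 L) x := by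
  let g₁ : ℝ → ℝ := IccExtend hL.le ((Icc 0 L).domRestrict g)
  have hg₁ : Continuous g₁ := (continuousOn_iff_continuous_domRestrict.1 hg).Icc_extend'
  have hgg₁ : EqOn g₁ g (Icc 0 L) := fun x hx => IccExtend_of_mem hL.le _ hx
  let F : ℝ → ℝ := fun x => ∫ t in (0 : ℝ)..x, g₁ t
  have hF (x : ℝ) : HasDerivAt F (g₁ x) x := (hg₁.integral_hasStrictDerivAt 0 x).hasDerivAt
  have hFc : Continuous F := continuous_iff_continuousAt.2 fun x => (hF x).continuousAt
  have hloc {p : ℝ → ℝ} (hp : ContinuousOn p (Icc 0 L)) : LocallyIntegrableOn p (Ioo 0 L) :=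
    (hp.integrableOn_Icc.mono_set Ioo_subset_Icc_self).locallyIntegrableOn
  obtain ⟨c, hc⟩ := ae_eq_const_of_integral_mul_deriv_eq_zero (h := fun x => f x - F x)
    isOpen_Ioo (nonempty_Ioo.2 hL) (hloc (hf.sub hFc.continuousOn)) fun η hη => by
      have hfF : ∫ x in Ioo 0 L, f x * deriv η x = ∫ x in Ioo 0 L, F x * deriv η x := by
        rw [h η hη.contDiff hη.hasCompactSupport hη.tsupport_subset,
          hasWeakDeriv_of_hasDerivAt hL.le hF hg₁ η hη.contDiff hη.hasCompactSupport
            hη.tsupport_subset]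
        exact congrArg Neg.neg (setIntegral_congr_fun measurableSet_Ioo fun x hx => by
          simp only [hgg₁ (Ioo_subset_Icc_self hx)])
      simp only [sub_mul]
      rw [integral_sub (hη.deriv.integrable_mul (hloc hf)).integrableOn
        (hη.deriv.integrable_mul (hloc hFc.continuousOn)).integrableOn, hfF, sub_self]
  have hconst : EqOn (fun x => f x - F x) (fun _ => c) (Icc 0 L) := by
    refine Measure.eqOn_Icc_of_ae_eq volume hL.ne ?_ (hf.sub hFc.continuousOn) continuousOn_const
    rwa [← restrict_Ioo_eq_restrict_Icc, EventuallyEq, ae_restrict_iff' measurableSet_Ioo]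
  rw [← hgg₁ hx]
  exact ((hF x).add_const c).hasDerivWithinAt.congr
    (fun y hy => sub_eq_iff_eq_add'.1 (hconst hy)) (sub_eq_iff_eq_add'.1 (hconst hx))

end WeakDerivatives

section BoundaryValueProblem

/-- The wave number of the cnoidal waves of modulus `k` which have `n` periods in the length `L`. -/
noncomputable def waveNumber (L k : ℝ) (n : ℕ) : ℝ :=
  4 * ellipticK k * n / L

variable {ε L₁ L w k s : ℝ} {n : ℕ}

lemma waveNumber_pos (hL : 0 < L) (hk : k ^ 2 < 1) (hn : 1 ≤ n) : 0 < waveNumber L k n := by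
  have hK := ellipticK_pos hk
  unfold waveNumber
  positivity

lemma isLeast_period_cnWave_waveNumber (hL : 0 < L) (hk : k ∈ moduli) (hn : 1 ≤ n) :
    IsLeast {T : ℝ | 0 < T ∧ Function.Periodic (cnWave (waveNumber L k n) k s) T} (L / n) := by
  have hk₁ := sq_lt_one_of_mem_moduli hk
  have hK := ellipticK_pos hk₁
  convert isLeast_period_cnWave (waveNumber_pos hL hk₁ hn) (pos_of_mem_moduli hk).ne' hk₁ using 1
  unfold waveNumber
  field_simp

lemma periodic_of_hasDerivAt {f f' : ℝ → ℝ} {T : ℝ} (hf : ∀ x, HasDerivAt f (f' x) x)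
    (hT : Function.Periodic f T) : Function.Periodic f' T := fun x => by
  have h := (hf (x + T)).comp_add_const x T
  simp only [hT _] at h
  exact h.unique (hf x)

lemma memLp_restrict_Ioo_of_continuous {f : ℝ → ℝ} (hf : Continuous f) (a b : ℝ) (p : ENNReal) :
    MemLp f p (volume.restrict (Ioo a b)) := by
  obtain ⟨C, hC⟩ := (isCompact_Icc (a := a) (b := b)).exists_bound_of_continuousOn hf.continuousOn
  refine MemLp.of_bound hf.aestronglyMeasurable C ?_
  filter_upwards [ae_restrict_mem measurableSet_Ioo] with x hx
  exact hC x (Ioo_subset_Icc_self hx)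

lemma isH2Per_of_hasDerivAt {u u' u'' : ℝ → ℝ} (hL : 0 ≤ L) (hu : ∀ x, HasDerivAt u (u' x) x)
    (hu' : ∀ x, HasDerivAt u' (u'' x) x) (hu'' : Continuous u'') (hper : Function.Periodic u L) :
    IsH2Per L u u' u'' := by
  have hc : Continuous u := continuous_iff_continuousAt.2 fun x => (hu x).continuousAt
  have hc' : Continuous u' := continuous_iff_continuousAt.2 fun x => (hu' x).continuousAt
  exact {
    memLp := memLp_restrict_Ioo_of_continuous hc 0 L 2
    memLp_fst := memLp_restrict_Ioo_of_continuous hc' 0 L 2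
    memLp_snd := memLp_restrict_Ioo_of_continuous hu'' 0 L 2
    weak_fst := hasWeakDeriv_of_hasDerivAt hL hu hc'
    weak_snd := hasWeakDeriv_of_hasDerivAt hL hu' hu''
    cont := hc.continuousOn
    cont_fst := hc'.continuousOn
    periodic := hper.eq.symm
    periodic_fst := (periodic_of_hasDerivAt hu hper).eq.symm }

lemma isH2Per_cnWave (hL : 0 ≤ L) (hk : k ^ 2 < 1) {b : ℝ}
    (hper : Function.Periodic (cnWave b k s) L) :
    IsH2Per L (cnWave b k s) (cnWaveDeriv b k s)
      fun x => b ^ 2 * (2 * k ^ 2 - 1) * cnWave b k s x - cnWave b k s x ^ 3 := by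
  have hc : Continuous (cnWave b k s) :=
    continuous_iff_continuousAt.2 fun _ => (hasDerivAt_cnWave hk).continuousAt
  exact isH2Per_of_hasDerivAt hL (fun _ => hasDerivAt_cnWave hk)
    (fun _ => hasDerivAt_cnWaveDeriv hk) (by fun_prop) hper

lemma HasWeakDeriv.congr_ae {f g h : ℝ → ℝ} (hfg : HasWeakDeriv L f g)
    (hgh : g =ᵐ[volume.restrict (Ioo 0 L)] h) : HasWeakDeriv L f h := fun η hη hηc hηs => by
  rw [hfg η hη hηc hηs]
  exact congrArg Neg.neg (integral_congr_ae (hgh.mul .rfl))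

lemma IsH2Per.hasDerivWithinAt_orbit {u u' u'' : ℝ → ℝ} (hL : 0 < L) (hu : IsH2Per L u u' u'')
    (heq : u'' =ᵐ[volume.restrict (Ioo 0 L)] fun x => w * u x - u x ^ 3) {x : ℝ}
    (hx : x ∈ Icc 0 L) :
    HasDerivWithinAt (fun x => (u x, u' x)) (cubicField w (u x, u' x)) (Icc 0 L) x := by
  have hcont : ContinuousOn (fun x => w * u x - u x ^ 3) (Icc 0 L) :=
    (hu.cont.const_mul w).sub (hu.cont.pow 3)
  exact (hu.weak_fst.hasDerivWithinAt hL hu.cont hu.cont_fst hx).prodMk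
    ((hu.weak_snd.congr_ae heq).hasDerivWithinAt hL hu.cont_fst hcont hx)

lemma ne_zero_of_orbit_of_periodic {u u' : ℝ → ℝ} (hw : 0 < w) (hL : 0 < L)
    (horb : ∀ x ∈ Icc 0 L,
      HasDerivWithinAt (fun x => (u x, u' x)) (cubicField w (u x, u' x)) (Icc 0 L) x)
    (hper : u 0 = u L) (h₀ : u 0 = √(2 * w)) : u' 0 ≠ 0 := fun h => by
  have hinit : (u 0, u' 0) = (soliton √w 0, solitonDeriv √w 0) := by
    simp [h₀, h, soliton, solitonDeriv]
  have heq := eqOn_Icc_of_locallyLipschitz (locallyLipschitz_cubicField w) horb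
    (fun x _ => (hasDerivAt_soliton_orbit hw.le x).hasDerivWithinAt) hinit
  have hlt := soliton_lt_soliton_zero (sqrt_pos.2 hw) hL.ne'
  rw [← (Prod.mk.inj hinit).1, ← (Prod.mk.inj (heq (right_mem_Icc.2 hL.le))).1] at hlt
  exact hlt.ne' hper

lemma exists_cnWave_eqOn {u u' : ℝ → ℝ} (hw : 0 < w) (hL : 0 < L)
    (horb : ∀ x ∈ Icc 0 L,
      HasDerivWithinAt (fun x => (u x, u' x)) (cubicField w (u x, u' x)) (Icc 0 L) x)
    (hper : u 0 = u L) (hper' : u' 0 = u' L) (h₀ : u 0 = √(2 * w)) :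
    ∃ n : ℕ, 1 ≤ n ∧ ∃ k ∈ moduli, ∃ s, waveNumber L k n ^ 2 * (2 * k ^ 2 - 1) = w ∧
      EqOn u (cnWave (waveNumber L k n) k s) (Icc 0 L) := by
  obtain ⟨b, hb, k, hk, s, hbw, hs, hs'⟩ :=
    exists_cnWave_initial hw (ne_zero_of_orbit_of_periodic hw hL horb hper h₀)
  have hk₁ := sq_lt_one_of_mem_moduli hk
  have heq := eqOn_Icc_of_locallyLipschitz (locallyLipschitz_cubicField w) horb
    (fun x _ => (hasDerivAt_cnWave_orbit (s := s) hk₁ hbw).hasDerivWithinAt)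
    (by rw [h₀, hs, hs'])
  have hL' := Prod.mk.inj (heq (right_mem_Icc.2 hL.le))
  obtain ⟨n, hn, hbn⟩ := exists_nat_of_cnWave_orbit_eq hb (pos_of_mem_moduli hk).ne' hk₁ hL
    (by rw [← hL'.1, hs, ← h₀, hper]) (by rw [← hL'.2, hs', hper'])
  rw [sub_zero] at hbn
  subst hbn
  exact ⟨n, hn, k, hk, s, hbw, fun x hx => (Prod.mk.inj (heq hx)).1⟩

lemma mem_solutionSet_iff (hL : 0 < L) (hL₁ : L₁ ∈ Icc 0 L) {p : ℝ × (Icc (0 : ℝ) L → ℝ)} :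
    p ∈ solutionSet ε L₁ L ↔ ∃ n : ℕ, 1 ≤ n ∧ ∃ k ∈ moduli, ∃ s,
      p = (-(waveNumber L k n ^ 2 * (2 * k ^ 2 - 1)),
        (Icc (0 : ℝ) L).domRestrict (cnWave (waveNumber L k n) k s)) ∧
      cnWave (waveNumber L k n) k s 0 = √(2 * (waveNumber L k n ^ 2 * (2 * k ^ 2 - 1))) ∧
      ε * cnWave (waveNumber L k n) k s L₁ =
        √(2 * (waveNumber L k n ^ 2 * (2 * k ^ 2 - 1))) := by
  obtain ⟨ω, v⟩ := p
  constructor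
  · rintro ⟨hω, u, u', u'', hu, hode, h₀, h₁, rfl⟩
    simp only [abs_of_neg hω] at hω hode h₀ h₁
    have horb := fun x => hu.hasDerivWithinAt_orbit (w := -ω) (x := x) hL <| by
      filter_upwards [hode] with x hx
      linarith
    obtain ⟨n, hn, k, hk, s, hkw, heq⟩ :=
      exists_cnWave_eqOn (neg_pos.2 hω) hL horb hu.periodic hu.periodic_fst h₀
    refine ⟨n, hn, k, hk, s, ?_, ?_, ?_⟩
    · rw [hkw, neg_neg, domRestrict_eq_domRestrict_iff.2 heq]
    · rw [hkw, ← heq (left_mem_Icc.2 hL.le), h₀]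
    · rw [hkw, ← heq hL₁, h₁]
  · rintro ⟨n, hn, k, hk, s, hp, h₀, h₁⟩
    obtain ⟨rfl, rfl⟩ := Prod.mk.inj hp
    have hk₁ := sq_lt_one_of_mem_moduli hk
    have hw : 0 < waveNumber L k n ^ 2 * (2 * k ^ 2 - 1) :=
      mul_pos (pow_pos (waveNumber_pos hL hk₁ hn) 2) (two_mul_sq_sub_one_pos hk)
    have hper : Function.Periodic (cnWave (waveNumber L k n) k s) L :=
      (periodic_cnWave_iff (waveNumber_pos hL hk₁ hn).ne' (pos_of_mem_moduli hk).ne' hk₁).2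
        ⟨n, div_mul_cancel₀ _ hL.ne'⟩
    refine ⟨neg_lt_zero.2 hw, _, _, _, isH2Per_cnWave hL.le hk₁ hper,
      Eventually.of_forall fun x => ?_, ?_, ?_, rfl⟩
    · ring
    · rw [h₀, abs_neg, abs_of_pos hw]
    · rw [h₁, abs_neg, abs_of_pos hw]

end BoundaryValueProblem

section Phases

/-- The phases `z` congruent to `±δ` modulo `1`, that is, those at which a wave of period `1`
with a maximum at the phase `0` takes the same value as at `δ`. -/
def PhaseEq (δ z : ℝ) : Prop :=
  ∃ m : ℤ, z = m + δ ∨ z = m - δ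

/-- The displacement of `x` from the nearest integer. -/
noncomputable def signedDist (x : ℝ) : ℝ :=
  x - round x

lemma signedDist_eq_of_eq_add {x y : ℝ} {m : ℤ} (hy : y ∈ Ico (-(1 / 2)) (1 / 2))
    (h : x = m + y) : signedDist x = y := by
  rw [signedDist, h, round_intCast_add, round_eq_zero_iff.2 hy]
  simp only [add_zero, add_sub_cancel_left]

lemma signedDist_mem_Ico (x : ℝ) : signedDist x ∈ Ico (-(1 / 2)) (1 / 2) := by
  obtain ⟨h₁, h₂⟩ := round_eq_iff.1 (rfl : round x = round x)
  constructor <;> unfold signedDist <;> linarith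

lemma signedDist_sub_half {x : ℝ} (hx : signedDist x ≠ 0) :
    signedDist (x - 1 / 2) = (|signedDist x| - 1 / 2) * Real.sign (signedDist x) := by
  obtain ⟨h₁, h₂⟩ := signedDist_mem_Ico x
  have hround : x = round x + signedDist x := (add_sub_cancel _ _).symm
  rcases hx.lt_or_gt with hneg | hpos
  · rw [abs_of_neg hneg, Real.sign_of_neg hneg]
    refine signedDist_eq_of_eq_add (m := round x - 1) ⟨by linarith, by linarith⟩ ?_
    push_cast
    linarith
  · rw [abs_of_pos hpos, Real.sign_of_pos hpos]
    exact signedDist_eq_of_eq_add (m := round x) ⟨by linarith, by linarith⟩ (by linarith)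

lemma two_mul_abs_signedDist_sub_half {x : ℝ} (hx : signedDist x ≠ 0) :
    2 * |signedDist (x - 1 / 2)| = 1 - 2 * |signedDist x| := by
  have hle : |signedDist x| ≤ 1 / 2 := abs_sub_round x
  rw [signedDist_sub_half hx, abs_mul, abs_of_nonpos (sub_nonpos.2 hle)]
  rcases hx.lt_or_gt with h | h
  · rw [Real.sign_of_neg h, abs_neg, abs_one]
    ring
  · rw [Real.sign_of_pos h, abs_one]
    ring

lemma two_mul_abs_signedDist_mem_Ioo {x : ℝ} (hx : Irrational x) :
    2 * |signedDist x| ∈ Ioo 0 1 := by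
  have hirr : Irrational (signedDist x) := hx.sub_intCast _
  obtain ⟨h₁, h₂⟩ := signedDist_mem_Ico x
  have h₃ : -(1 / 2) ≠ signedDist x := fun h => hirr ⟨-(1 / 2), by push_cast; exact h⟩
  have h₄ := abs_lt.2 ⟨lt_of_le_of_ne h₁ h₃, h₂⟩
  exact ⟨mul_pos two_pos (abs_pos.2 hirr.ne_zero), by linarith⟩

/-- Crossings with slopes of the same sign differ by a whole number of periods, so `z` must lie
halfway between two crossings with slopes of opposite signs. -/
lemma phaseEq_and_phaseEq_iff {φ β z : ℝ} (hφ : φ ∈ Ioo 0 1) (hβ : signedDist β ≠ 0) :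
    PhaseEq (φ / 4) (-z) ∧ PhaseEq (φ / 4) (β - z) ↔
      φ = 2 * |signedDist β| ∧ ∃ m : ℤ, z = m + signedDist β / 2 := by
  obtain ⟨hφ₀, hφ₁⟩ := hφ
  have hint (m : ℤ) : β ≠ m := fun h =>
    hβ (signedDist_eq_of_eq_add (m := m) (by norm_num) (by rw [h, add_zero]))
  constructor
  · rintro ⟨⟨m, hm | hm⟩, ⟨l, hl | hl⟩⟩
    · exact absurd (by push_cast; linarith) (hint (l - m))
    · have hdist : signedDist β = -(φ / 2) :=
        signedDist_eq_of_eq_add (m := l - m) ⟨by linarith, by linarith⟩ (by push_cast; linarith)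
      rw [hdist, abs_neg, abs_of_pos (by positivity)]
      exact ⟨by ring, -m, by push_cast; linarith⟩
    · have hdist : signedDist β = φ / 2 :=
        signedDist_eq_of_eq_add (m := l - m) ⟨by linarith, by linarith⟩ (by push_cast; linarith)
      rw [hdist, abs_of_pos (by positivity)]
      exact ⟨by ring, -m, by push_cast; linarith⟩
    · exact absurd (by push_cast; linarith) (hint (l - m))
  · rintro ⟨rfl, m, rfl⟩
    have hround : β = round β + signedDist β := (add_sub_cancel _ _).symm
    rcases abs_choice (signedDist β) with h | h <;> rw [h]
    · exact ⟨⟨-m, .inr (by push_cast; ring)⟩, ⟨round β - m, .inl (by push_cast; linarith)⟩⟩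
    · exact ⟨⟨-m, .inl (by push_cast; ring)⟩, ⟨round β - m, .inr (by push_cast; linarith)⟩⟩

end Phases

section Levels

variable {ε L L₁ k s x : ℝ} {n : ℕ}

lemma jacobiCn_four_mul_ellipticK_mul_eq_iff (hk : k ^ 2 < 1) {z δ : ℝ} :
    jacobiCn (4 * ellipticK k * z) k = jacobiCn (4 * ellipticK k * δ) k ↔ PhaseEq δ z := by
  have hK : 4 * ellipticK k ≠ 0 := (mul_pos four_pos (ellipticK_pos hk)).ne'
  rw [eq_comm, jacobiCn_eq_iff hk]
  simp only [← mul_add, ← mul_sub, mul_right_inj' hK, PhaseEq]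

lemma cnWave_waveNumber_eq_sqrt_iff (hL : 0 < L) (hk : k ∈ moduli) (hn : 1 ≤ n) :
    cnWave (waveNumber L k n) k s x = √(2 * (waveNumber L k n ^ 2 * (2 * k ^ 2 - 1))) ↔
      PhaseEq (phi k / 4) (n / L * (x - s)) := by
  have hk₁ := sq_lt_one_of_mem_moduli hk
  rw [cnWave_eq_sqrt_iff (waveNumber_pos hL hk₁ hn) hk rfl,
    ← jacobiCn_four_mul_ellipticK_mul_eq_iff hk₁, waveNumber]
  ring_nf

/-- Half a period reverses the sign of `cn`: this is how the sign in `(P₋)` becomes a shift. -/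
lemma sign_mul_cnWave_waveNumber (hL : 0 < L) (hk : k ∈ moduli) (hn : 1 ≤ n)
    (hε : ε = 1 ∨ ε = -1) :
    ε * cnWave (waveNumber L k n) k s x =
      cnWave (waveNumber L k n) k (s + L / n * ((1 - ε) / 4)) x := by
  have hn₀ : (n : ℝ) ≠ 0 := by positivity
  rcases hε with rfl | rfl
  · rw [one_mul, sub_self, zero_div, mul_zero, add_zero]
  · have hshift : waveNumber L k n * (x - (s + L / n * ((1 - -1) / 4))) =
        waveNumber L k n * (x - s) - 2 * ellipticK k := by
      unfold waveNumber
      field_simp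
      ring
    rw [cnWave, cnWave, hshift, (jacobiCn_antiperiodic (sq_lt_one_of_mem_moduli hk)).sub_eq]
    ring

lemma cnWave_add_mul_div (hL : 0 < L) (hk : k ∈ moduli) (hn : 1 ≤ n) (m : ℤ) :
    cnWave (waveNumber L k n) k (s + m * (L / n)) = cnWave (waveNumber L k n) k s := by
  funext x
  have hper := (isLeast_period_cnWave_waveNumber (s := s) hL hk hn).1.2.int_mul m (x - m * (L / n))
  rw [sub_add_cancel] at hper
  rw [hper, cnWave, cnWave, sub_sub, add_comm s]

/-- Twice the phase `n s / L` of the maximum point `s` of the `n`-th solution; the term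
`(1 - ε) / 4` is the half period which absorbs the sign `ε`. -/
noncomputable def phaseShift (ε L₁ L : ℝ) (n : ℕ) : ℝ :=
  signedDist (L₁ / L * n - (1 - ε) / 4)

lemma cnWave_levels_iff (hε : ε = 1 ∨ ε = -1) (hL : 0 < L) (hk : k ∈ moduli) (hn : 1 ≤ n)
    (h : phaseShift ε L₁ L n ≠ 0) :
    cnWave (waveNumber L k n) k s 0 = √(2 * (waveNumber L k n ^ 2 * (2 * k ^ 2 - 1))) ∧
        ε * cnWave (waveNumber L k n) k s L₁ =
          √(2 * (waveNumber L k n ^ 2 * (2 * k ^ 2 - 1))) ↔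
      phi k = 2 * |phaseShift ε L₁ L n| ∧ ∃ m : ℤ, n / L * s = m + phaseShift ε L₁ L n / 2 := by
  have hn₀ : (n : ℝ) ≠ 0 := by positivity
  have h₀ : n / L * (0 - s) = -(n / L * s) := by ring
  have h₁ : n / L * (L₁ - (s + L / n * ((1 - ε) / 4))) =
      L₁ / L * n - (1 - ε) / 4 - n / L * s := by
    field_simp
    ring
  rw [sign_mul_cnWave_waveNumber hL hk hn hε, cnWave_waveNumber_eq_sqrt_iff hL hk hn,
    cnWave_waveNumber_eq_sqrt_iff hL hk hn, h₀, h₁]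
  exact phaseEq_and_phaseEq_iff (phi_mem_Ioo hk) h

end Levels

section ExplicitSolutions

variable {ε L L₁ y s : ℝ} {n : ℕ}

/-- The frequency `ω < 0` with `√|ω| = n G(y) / L`. -/
noncomputable def frequency (L y : ℝ) (n : ℕ) : ℝ :=
  -(n / L * G y) ^ 2

lemma frequency_iff (hL : 0 < L) (hy : y ∈ Ioo 0 1) (hn : 1 ≤ n) (ω : ℝ) :
    ω < 0 ∧ √|ω| = n / L * G y ↔ ω = frequency L y n := by
  have hG := G_pos hy
  have hpos : 0 < n / L * G y := by positivity
  constructor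
  · rintro ⟨hω, h⟩
    rw [frequency, ← h, sq_sqrt (abs_nonneg ω), abs_of_neg hω, neg_neg]
  · rintro rfl
    rw [frequency, abs_neg, abs_of_pos (by positivity), sqrt_sq hpos.le]
    exact ⟨by simpa only [neg_lt_zero] using pow_pos hpos 2, rfl⟩

lemma frequency_eq_neg_waveNumber_sq_mul (hy : y ∈ Ioo 0 1) :
    frequency L y n =
      -(waveNumber L (phiInv y) n ^ 2 * (2 * phiInv y ^ 2 - 1)) := by
  have hk := two_mul_sq_sub_one_pos (phiInv_mem_moduli hy)
  rw [frequency, G, S, waveNumber, mul_pow, mul_pow, mul_pow, sq_sqrt hk.le]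
  ring

lemma modulus_frequency (hL : 0 < L) (hy : y ∈ Ioo 0 1) (hn : 1 ≤ n) :
    modulus L (frequency L y n) n = phiInv y := by
  have hn₀ : (n : ℝ) ≠ 0 := by positivity
  rw [modulus, ((frequency_iff hL hy hn _).2 rfl).2, ← SInv_S (phiInv_mem_moduli hy), G]
  congr 1
  field_simp

lemma profile_frequency (hL : 0 < L) (hy : y ∈ Ioo 0 1) (hn : 1 ≤ n) :
    profile L (frequency L y n) n s = cnWave (waveNumber L (phiInv y) n) (phiInv y) s := by
  have hk := phiInv_mem_moduli hy
  have hd := two_mul_sq_sub_one_pos hk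
  have hb := waveNumber_pos hL (sq_lt_one_of_mem_moduli hk) hn
  have hω : |frequency L y n| = waveNumber L (phiInv y) n ^ 2 * (2 * phiInv y ^ 2 - 1) := by
    rw [frequency_eq_neg_waveNumber_sq_mul hy, abs_neg, abs_of_pos (by positivity)]
  have hamp : 2 * (waveNumber L (phiInv y) n ^ 2 * (2 * phiInv y ^ 2 - 1)) * phiInv y ^ 2 /
      (2 * phiInv y ^ 2 - 1) = 2 * (phiInv y * waveNumber L (phiInv y) n) ^ 2 := by
    field_simp
  funext x
  rw [profile, modulus_frequency hL hy hn, hω, mul_div_cancel_right₀ _ hd.ne', sqrt_sq hb.le, hamp,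
    sqrt_mul zero_le_two, sqrt_sq (mul_pos (pos_of_mem_moduli hk) hb).le,
    cnWave, mul_assoc √2 (phiInv y)]

lemma isLeast_period_profile (hL : 0 < L) (hy : y ∈ Ioo 0 1) (hn : 1 ≤ n) :
    IsLeast {T : ℝ | 0 < T ∧ Function.Periodic (profile L (frequency L y n) n s) T} (L / n) := by
  rw [profile_frequency hL hy hn]
  exact isLeast_period_cnWave_waveNumber hL (phiInv_mem_moduli hy) hn

lemma periodic_profile (hL : 0 < L) (hy : y ∈ Ioo 0 1) (hn : 1 ≤ n) :
    Function.Periodic (profile L (frequency L y n) n s) L := by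
  have h := (isLeast_period_profile (s := s) hL hy hn).1.2.nat_mul n
  rwa [mul_div_cancel₀ _ (by positivity)] at h

lemma eq_of_periodic_of_eqOn_Icc {f g : ℝ → ℝ} (hL : 0 < L) (hf : Function.Periodic f L)
    (hg : Function.Periodic g L) (h : EqOn f g (Icc 0 L)) : f = g := by
  funext x
  have hx := toIcoMod_mem_Ico hL 0 x
  rw [zero_add] at hx
  rw [← hf.sub_zsmul_eq (toIcoDiv hL 0 x), ← hg.sub_zsmul_eq (toIcoDiv hL 0 x)]
  exact h (Ico_subset_Icc_self hx)

end ExplicitSolutions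

section Families

variable {ε L L₁ : ℝ} {y s : ℕ → ℝ} {n : ℕ}

/-- The pairs `(ω_n, u_n)`, `n ≥ 1`, where `ω_n` is the frequency with parameter `y n` and `u_n` is
the cnoidal wave of that frequency with `n` periods in `[0, L]`, translated by `s n`. -/
def cnoidalFamily (L : ℝ) (y s : ℕ → ℝ) : Set (ℝ × (Icc (0 : ℝ) L → ℝ)) :=
  {p | ∃ n : ℕ, 1 ≤ n ∧ p = (frequency L (y n) n,
    (Icc (0 : ℝ) L).domRestrict (profile L (frequency L (y n) n) n (s n)))}

lemma countable_cnoidalFamily : (cnoidalFamily L y s).Countable := by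
  refine (countable_range fun n : ℕ => (frequency L (y n) n,
    (Icc (0 : ℝ) L).domRestrict (profile L (frequency L (y n) n) n (s n)))).mono ?_
  rintro p ⟨n, -, rfl⟩
  exact mem_range_self n

lemma infinite_cnoidalFamily (hL : 0 < L) (hy : ∀ n, 1 ≤ n → y n ∈ Ioo 0 1) :
    (cnoidalFamily L y s).Infinite := by
  refine infinite_of_injOn_mapsTo (f := fun n : ℕ => (frequency L (y n) n,
    (Icc (0 : ℝ) L).domRestrict (profile L (frequency L (y n) n) n (s n))))
    (fun m hm n hn hmn => ?_) (fun n hn => ⟨n, hn, rfl⟩) (Ici_infinite 1)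
  have hprofile := eq_of_periodic_of_eqOn_Icc hL (periodic_profile hL (hy m hm) hm)
    (periodic_profile hL (hy n hn) hn) (domRestrict_eq_domRestrict_iff.1 (congrArg Prod.snd hmn))
  have hleast := isLeast_period_profile (s := s m) hL (hy m hm) hm
  rw [hprofile] at hleast
  have hperiod := hleast.unique (isLeast_period_profile hL (hy n hn) hn)
  rw [div_eq_mul_inv, div_eq_mul_inv, mul_right_inj' hL.ne', inv_inj] at hperiod
  exact Nat.cast_injective hperiod

lemma solutionSet_eq_cnoidalFamily (hε : ε = 1 ∨ ε = -1) (hL : 0 < L) (hL₁ : L₁ ∈ Icc 0 L)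
    (hy : ∀ n, 1 ≤ n → y n ∈ Ioo 0 1) (hshift : ∀ n, 1 ≤ n → y n = 2 * |phaseShift ε L₁ L n|)
    (hs : ∀ n, 1 ≤ n → s n = L / (2 * n) * phaseShift ε L₁ L n) :
    solutionSet ε L₁ L = cnoidalFamily L y s := by
  ext p
  rw [mem_solutionSet_iff hL hL₁]
  refine exists_congr fun n => and_congr_right fun hn => ?_
  have hn₀ : (n : ℝ) ≠ 0 := by positivity
  have hne : phaseShift ε L₁ L n ≠ 0 :=
    abs_pos.1 (pos_of_mul_pos_right (hshift n hn ▸ (hy n hn).1) zero_le_two)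
  have hsn : n / L * s n = phaseShift ε L₁ L n / 2 := by
    rw [hs n hn]
    field_simp
  rw [profile_frequency hL (hy n hn) hn, frequency_eq_neg_waveNumber_sq_mul (hy n hn)]
  constructor
  · rintro ⟨k, hk, t, rfl, hlevels⟩
    obtain ⟨hφ, m, hm⟩ := (cnWave_levels_iff hε hL hk hn hne).1 hlevels
    have ht : t = s n + m * (L / n) := by
      rw [← hsn] at hm
      field_simp at hm ⊢
      linarith
    rw [hshift n hn, ← hφ, phiInv_phi hk, ht, cnWave_add_mul_div hL hk hn]
  · rintro rfl
    have hk := phiInv_mem_moduli (hy n hn)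
    refine ⟨_, hk, _, rfl, (cnWave_levels_iff hε hL hk hn hne).2 ⟨?_, 0, ?_⟩⟩
    · rw [phi_phiInv (hy n hn), hshift n hn]
    · rw [hsn, Int.cast_zero, zero_add]

end Families

section Parameters

variable {L L₁ : ℝ} {n : ℕ}

lemma r_eq_signedDist : r L₁ L n = signedDist (L₁ / L * n) := by
  rw [r, signedDist, round_eq]

lemma phaseShift_one : phaseShift 1 L₁ L n = r L₁ L n := by
  rw [phaseShift, r_eq_signedDist, sub_self, zero_div, sub_zero]

lemma phaseShift_neg_one (hr : r L₁ L n ≠ 0) :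
    phaseShift (-1) L₁ L n = (|r L₁ L n| - 1 / 2) * Real.sign (r L₁ L n) := by
  rw [r_eq_signedDist] at hr ⊢
  rw [← signedDist_sub_half hr, phaseShift]
  norm_num

lemma two_mul_abs_phaseShift_neg_one (hr : r L₁ L n ≠ 0) :
    2 * |phaseShift (-1) L₁ L n| = 1 - xi L₁ L n := by
  rw [xi, r_eq_signedDist, ← two_mul_abs_signedDist_sub_half (r_eq_signedDist ▸ hr), phaseShift]
  norm_num

lemma xi_mem_Ioo (hirr : Irrational (L₁ / L)) (hn : 1 ≤ n) : xi L₁ L n ∈ Ioo 0 1 := by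
  rw [xi, r_eq_signedDist]
  exact two_mul_abs_signedDist_mem_Ioo (hirr.mul_natCast (Nat.one_le_iff_ne_zero.1 hn))

lemma r_ne_zero (hirr : Irrational (L₁ / L)) (hn : 1 ≤ n) : r L₁ L n ≠ 0 :=
  abs_pos.1 (pos_of_mul_pos_right (xi_mem_Ioo hirr hn).1 zero_le_two)

lemma solutionSet_one_eq (hL : 0 < L) (hL₁ : L₁ ∈ Icc 0 L) (hirr : Irrational (L₁ / L)) :
    solutionSet 1 L₁ L = cnoidalFamily L (xi L₁ L) (sPlus L₁ L) :=
  solutionSet_eq_cnoidalFamily (.inl rfl) hL hL₁ (fun _ hn => xi_mem_Ioo hirr hn)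
    (fun _ _ => by rw [phaseShift_one, xi]) (fun _ _ => by rw [phaseShift_one, sPlus])

lemma solutionSet_neg_one_eq (hL : 0 < L) (hL₁ : L₁ ∈ Icc 0 L) (hirr : Irrational (L₁ / L)) :
    solutionSet (-1) L₁ L = cnoidalFamily L (fun n => 1 - xi L₁ L n) (sMinus L₁ L) :=
  solutionSet_eq_cnoidalFamily (.inr rfl) hL hL₁
    (fun _ hn => Ioo.one_sub_mem (xi_mem_Ioo hirr hn))
    (fun _ hn => (two_mul_abs_phaseShift_neg_one (r_ne_zero hirr hn)).symm)
    (fun _ hn => by rw [phaseShift_neg_one (r_ne_zero hirr hn), sMinus, mul_assoc])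

end Parameters

end DoubleBridge

theorem theorem1_general (L₁ L : ℝ) (hL₁ : 0 < L₁) (hL₁L : L₁ < L) (hirr : Irrational (L₁ / L)) :
    Set.BijOn DoubleBridge.S DoubleBridge.moduli (Set.Ioi 0) ∧
    Set.BijOn DoubleBridge.phi DoubleBridge.moduli (Set.Ioo 0 1) ∧
    (∀ n : ℕ, 1 ≤ n → DoubleBridge.xi L₁ L n ∈ Set.Ioo (0 : ℝ) 1) ∧
    ∃ ωp ωm : ℕ → ℝ,
      (∀ n : ℕ, 1 ≤ n → ∀ ω : ℝ,
        (ω < 0 ∧ Real.sqrt |ω| = n / L * DoubleBridge.G (DoubleBridge.xi L₁ L n)) ↔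
          ω = ωp n) ∧
      (∀ n : ℕ, 1 ≤ n → ∀ ω : ℝ,
        (ω < 0 ∧ Real.sqrt |ω| = n / L * DoubleBridge.G (1 - DoubleBridge.xi L₁ L n)) ↔
          ω = ωm n) ∧
      DoubleBridge.solutionSet 1 L₁ L =
        {p | ∃ n : ℕ, 1 ≤ n ∧ p = (ωp n, (Set.Icc (0 : ℝ) L).domRestrict
          (DoubleBridge.profile L (ωp n) n (DoubleBridge.sPlus L₁ L n)))} ∧
      DoubleBridge.solutionSet (-1) L₁ L =
        {p | ∃ n : ℕ, 1 ≤ n ∧ p = (ωm n, (Set.Icc (0 : ℝ) L).domRestrict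
          (DoubleBridge.profile L (ωm n) n (DoubleBridge.sMinus L₁ L n)))} ∧
      ((DoubleBridge.solutionSet 1 L₁ L).Countable ∧
        (DoubleBridge.solutionSet 1 L₁ L).Infinite) ∧
      ((DoubleBridge.solutionSet (-1) L₁ L).Countable ∧
        (DoubleBridge.solutionSet (-1) L₁ L).Infinite) ∧
      (∀ n : ℕ, 1 ≤ n → IsLeast {T : ℝ | 0 < T ∧ Function.Periodic
        (DoubleBridge.profile L (ωp n) n (DoubleBridge.sPlus L₁ L n)) T} (L / n)) ∧
      (∀ n : ℕ, 1 ≤ n → IsLeast {T : ℝ | 0 < T ∧ Function.Periodic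
        (DoubleBridge.profile L (ωm n) n (DoubleBridge.sMinus L₁ L n)) T} (L / n)) := by
  have hL : 0 < L := hL₁.trans hL₁L
  have hmem : L₁ ∈ Set.Icc 0 L := ⟨hL₁.le, hL₁L.le⟩
  have hxi (n : ℕ) (hn : 1 ≤ n) := DoubleBridge.xi_mem_Ioo hirr hn
  have hxi' (n : ℕ) (hn : 1 ≤ n) := Set.Ioo.one_sub_mem (hxi n hn)
  have hplus := DoubleBridge.solutionSet_one_eq hL hmem hirr
  have hminus := DoubleBridge.solutionSet_neg_one_eq hL hmem hirr
  refine ⟨DoubleBridge.bijOn_S, DoubleBridge.bijOn_phi, hxi,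
    fun n => DoubleBridge.frequency L (DoubleBridge.xi L₁ L n) n,
    fun n => DoubleBridge.frequency L (1 - DoubleBridge.xi L₁ L n) n,
    fun n hn => DoubleBridge.frequency_iff hL (hxi n hn) hn,
    fun n hn => DoubleBridge.frequency_iff hL (hxi' n hn) hn, hplus, hminus, ?_, ?_,
    fun n hn => DoubleBridge.isLeast_period_profile hL (hxi n hn) hn,
    fun n hn => DoubleBridge.isLeast_period_profile hL (hxi' n hn) hn⟩
  · rw [hplus]
    exact ⟨DoubleBridge.countable_cnoidalFamily, DoubleBridge.infinite_cnoidalFamily hL hxi⟩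
  · rw [hminus]
    exact ⟨DoubleBridge.countable_cnoidalFamily, DoubleBridge.infinite_cnoidalFamily hL hxi'⟩

theorem theorem1 (L₁ L₂ L : ℝ) (hL₁ : 0 < L₁) (hL₂ : L₁ ≤ L₂) (hL : L = L₁ + L₂)
    (hirr : Irrational (L₁ / L)) :
    -- the inverse functions of `S` and `φ` exist, and `G` is evaluated in its domain
    Set.BijOn DoubleBridge.S DoubleBridge.moduli (Set.Ioi 0) ∧
    Set.BijOn DoubleBridge.phi DoubleBridge.moduli (Set.Ioo 0 1) ∧
    (∀ n : ℕ, 1 ≤ n → DoubleBridge.xi L₁ L n ∈ Set.Ioo (0 : ℝ) 1) ∧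
    ∃ ωp ωm : ℕ → ℝ,
      -- the frequencies
      (∀ n : ℕ, 1 ≤ n → ∀ ω : ℝ,
        (ω < 0 ∧ Real.sqrt |ω| = n / L * DoubleBridge.G (DoubleBridge.xi L₁ L n)) ↔
          ω = ωp n) ∧
      (∀ n : ℕ, 1 ≤ n → ∀ ω : ℝ,
        (ω < 0 ∧ Real.sqrt |ω| = n / L * DoubleBridge.G (1 - DoubleBridge.xi L₁ L n)) ↔
          ω = ωm n) ∧
      -- the solutions
      DoubleBridge.solutionSet 1 L₁ L =
        {p | ∃ n : ℕ, 1 ≤ n ∧ p = (ωp n, (Set.Icc (0 : ℝ) L).domRestrict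
          (DoubleBridge.profile L (ωp n) n (DoubleBridge.sPlus L₁ L n)))} ∧
      DoubleBridge.solutionSet (-1) L₁ L =
        {p | ∃ n : ℕ, 1 ≤ n ∧ p = (ωm n, (Set.Icc (0 : ℝ) L).domRestrict
          (DoubleBridge.profile L (ωm n) n (DoubleBridge.sMinus L₁ L n)))} ∧
      -- they form countable, and not finite, families
      ((DoubleBridge.solutionSet 1 L₁ L).Countable ∧
        (DoubleBridge.solutionSet 1 L₁ L).Infinite) ∧
      ((DoubleBridge.solutionSet (-1) L₁ L).Countable ∧
        (DoubleBridge.solutionSet (-1) L₁ L).Infinite) ∧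
      -- the least positive period of the `n`-th solution is `L / n`
      (∀ n : ℕ, 1 ≤ n → IsLeast {T : ℝ | 0 < T ∧ Function.Periodic
        (DoubleBridge.profile L (ωp n) n (DoubleBridge.sPlus L₁ L n)) T} (L / n)) ∧
      (∀ n : ℕ, 1 ≤ n → IsLeast {T : ℝ | 0 < T ∧ Function.Periodic
        (DoubleBridge.profile L (ωm n) n (DoubleBridge.sMinus L₁ L n)) T} (L / n)) := by
  exact theorem1_general L₁ L hL₁ (by linarith) hirr
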